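/- Let $\Omega=\mathbb R^2/\Lambda$ be a flat two-dimensional torus with area $|\Omega|=1$. For an integer $N\ge 1$, points $p_1,\dots,p_N\in\Omega$ (not necessarily distinct) and $\varepsilon>0$, consider the equation $$\Delta u+\frac1{\varepsilon^2}e^u(1-e^u)=4\pi\sum_{i=1}^N\delta_{p_i}\quad\text{in }\Omega, \qquad (1)$$ where $\delta_p$ is the Dirac measure at $p$. A solution is a function $u\in L^1(\Omega)$ with $e^u(1-e^u)\in L^1(\Omega)$ that satisfies (1) in the sense of distributions on $\Omega$; a maximal solution is a solution $u$ such that $v\le u$ almost everywhere for every solution $v$ of (1). Then there are a constant $c>0$ and numbers $\varepsilon(N)>0$, $N=1,2,3,\dots$ (all depending on $\Omega$ but not on the points $p_i$; $c$ does not depend on $N$), with $$\varepsilon(N)\ge N^{-cN}\quad\text{for all }N\ge 2,$$ such that, for every $N\ge1$, every configuration $p_1,\dots,p_N\in\Omega$ and every $0<\varepsilon<\varepsilon(N)$, equation (1) has a maximal solution. -/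

import Mathlib

open MeasureTheory
open scoped ContDiff

noncomputable section

/-- The Euclidean plane. -/
abbrev Plane : Type := EuclideanSpace ℝ (Fin 2)

/-- The flat torus `ℝ² / (ℤ b₀ + ℤ b₁)` spanned by a basis `b` of the plane. -/
abbrev FlatTorus (b : Module.Basis (Fin 2) ℝ Plane) : Type :=
  Plane ⧸ (Submodule.span ℤ (Set.range b)).toAddSubgroup

namespace FlatTorus

variable {b : Module.Basis (Fin 2) ℝ Plane}

/-- The covering map from the plane to the torus. -/
def proj (b : Module.Basis (Fin 2) ℝ Plane) (y : Plane) : FlatTorus b :=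
  QuotientAddGroup.mk y

theorem measurable_proj (b : Module.Basis (Fin 2) ℝ Plane) : Measurable (proj b) :=
  fun _ hs => hs

/-- The area measure of the flat torus: Lebesgue measure on a fundamental parallelogram,
pushed forward to the torus. -/
def area (b : Module.Basis (Fin 2) ℝ Plane) : Measure (FlatTorus b) :=
  Measure.map (proj b) (volume.restrict (ZSpan.fundamentalDomain b))

theorem area_univ (b : Module.Basis (Fin 2) ℝ Plane) :
    area b Set.univ = volume (ZSpan.fundamentalDomain b) := by
  rw [area, Measure.map_apply (measurable_proj b) MeasurableSet.univ]
  simp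

/-- Smooth functions on the torus: the lift to the plane is smooth. -/
def Smooth (φ : FlatTorus b → ℝ) : Prop :=
  ContDiff ℝ ∞ (fun y : Plane => φ (proj b y))

/-- The Laplacian of the flat metric: at `x`, it is the Euclidean Laplacian at the origin of
`φ` read in the flat chart `y ↦ x + [y]`. -/
def laplacian (φ : FlatTorus b → ℝ) (x : FlatTorus b) : ℝ :=
  Laplacian.laplacian (fun y : Plane => φ (x + proj b y)) 0

/-- `u` solves `Δu + ε⁻² eᵘ (1 - eᵘ) = 4π ∑ᵢ δ_{pᵢ}` on the torus in the sense of distributions: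
`u` and the nonlinear term `eᵘ (1 - eᵘ)` are integrable, and the equation holds when paired
with every smooth function on the torus. The `pᵢ` need not be distinct. -/
structure IsVortexSolution {N : ℕ} (p : Fin N → FlatTorus b) (ε : ℝ)
    (u : FlatTorus b → ℝ) : Prop where
  integrable : Integrable u (area b)
  integrable_nonlinear : Integrable (fun x => Real.exp (u x) * (1 - Real.exp (u x))) (area b)
  equation : ∀ φ : FlatTorus b → ℝ, Smooth φ →
    ∫ x, u x * laplacian φ x ∂(area b)
      + 1 / ε ^ 2 * ∫ x, Real.exp (u x) * (1 - Real.exp (u x)) * φ x ∂(area b)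
      = 4 * Real.pi * ∑ i, φ (p i)

/-- A maximal solution: a solution that dominates every solution almost everywhere. -/
structure IsMaximalVortexSolution {N : ℕ} (p : Fin N → FlatTorus b) (ε : ℝ)
    (u : FlatTorus b → ℝ) : Prop where
  isSolution : IsVortexSolution p ε u
  maximal : ∀ v : FlatTorus b → ℝ, IsVortexSolution p ε v → ∀ᵐ x ∂(area b), v x ≤ u x

end FlatTorus

end

open scoped Pointwise

noncomputable section

set_option linter.unusedSectionVars false

namespace FlatTorus

variable {b : Module.Basis (Fin 2) ℝ Plane}

/-! ### Topology and invariant measure of the torus -/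

/-! Put h = -u and K = 1/ε². Adding Kh to the equation and inverting K - Δ turns it into h = R(damp
h) + (4π/K) R(∑ δ_{pᵢ}), where R = K(K - Δ)⁻¹ and damp t = t - e⁻ᵗ(1 - e⁻ᵗ). The operator R is
convolution with a probability measure (the heat kernel at an exponentially distributed time), so it
preserves order, and damp is increasing on [0, ∞). Hence the iteration started at 0 increases and
stays below every nonnegative supersolution (`iterLimit_le`). Solutions satisfy u ≤ 0 by a maximum
principle (`IsVortexSolution.ae_nonpos`), so -u is always such a supersolution, and a single
nonnegative supersolution gives both existence and maximality (`exists_isMaximalVortexSolution`).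
Comparing Fourier coefficients passes between the distributional and the integral form, without
regularity theory.

The supersolution (`exists_supersolution`) solves -Δh = 4π ∑ δ_{pᵢ} - G, with G constant on a set E
and zero elsewhere. The operator R for K = 1 dominates c times the mean value, so the rest of its
kernel has mass 1 - c and a Neumann series solves Poisson's equation with bounds of order 1/c. The
potential of the sources has integral O(N); by Markov's inequality it is O(N) on a set E of area at
least 1/2, wherever the points lie. There h = O(N) and G = O(N), so K ≥ e^{CN} suffices. The
threshold found is thus exponential in N, which is stronger than N^{-cN}. -/

instance isClosed_lattice (b : Module.Basis (Fin 2) ℝ Plane) :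
    IsClosed ((Submodule.span ℤ (Set.range b)).toAddSubgroup : Set Plane) :=
  AddSubgroup.isClosed_of_discrete

instance countable_lattice (b : Module.Basis (Fin 2) ℝ Plane) :
    Countable (Submodule.span ℤ (Set.range b)).toAddSubgroup :=
  inferInstanceAs (Countable (Submodule.span ℤ (Set.range b)))

theorem continuous_proj (b : Module.Basis (Fin 2) ℝ Plane) : Continuous (proj b) :=
  QuotientAddGroup.continuous_mk

theorem proj_surjective (b : Module.Basis (Fin 2) ℝ Plane) : Function.Surjective (proj b) :=
  QuotientAddGroup.mk_surjective

theorem isQuotientMap_proj (b : Module.Basis (Fin 2) ℝ Plane) : Topology.IsQuotientMap (proj b) :=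
  QuotientAddGroup.isQuotientMap_mk _

theorem proj_add (b : Module.Basis (Fin 2) ℝ Plane) (y z : Plane) :
    proj b (y + z) = proj b y + proj b z := rfl

theorem proj_neg (b : Module.Basis (Fin 2) ℝ Plane) (y : Plane) :
    proj b (-y) = -proj b y := rfl

theorem proj_eq_proj_iff {y z : Plane} :
    proj b y = proj b z ↔ -y + z ∈ Submodule.span ℤ (Set.range b) :=
  QuotientAddGroup.eq

theorem proj_fract (b : Module.Basis (Fin 2) ℝ Plane) (y : Plane) :
    proj b (ZSpan.fract b y) = proj b y := by
  rw [proj_eq_proj_iff, ← ZSpan.fract_eq_fract, ZSpan.fract_fract]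

instance compactSpace : CompactSpace (FlatTorus b) := by
  have hK : IsCompact (closure (ZSpan.fundamentalDomain b)) :=
    (ZSpan.fundamentalDomain_isBounded b).isCompact_closure
  have := hK.image (continuous_proj b)
  refine ⟨?_⟩
  convert this
  refine (Set.eq_univ_of_forall fun x => ?_).symm
  obtain ⟨y, rfl⟩ := proj_surjective b x
  exact ⟨_, subset_closure (ZSpan.fract_mem_fundamentalDomain b y), proj_fract b y⟩

theorem area_apply {A : Set (FlatTorus b)} (hA : MeasurableSet A) :
    area b A = volume (proj b ⁻¹' A ∩ ZSpan.fundamentalDomain b) := by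
  rw [area, Measure.map_apply (measurable_proj b) hA,
    Measure.restrict_apply (measurable_proj b hA)]

/-- The preimage of A in the plane is lattice periodic, so it has the same measure in every
fundamental domain, in particular in the translated parallelogram. -/
instance isAddLeftInvariant_area (b : Module.Basis (Fin 2) ℝ Plane) :
    (area b).IsAddLeftInvariant := by
  refine ⟨fun x => ?_⟩
  obtain ⟨a, rfl⟩ := proj_surjective b x
  ext A hA
  have hD := ZSpan.isAddFundamentalDomain' b (volume : Measure Plane)
  rw [Measure.map_apply (measurable_const_add _) hA, area_apply (measurable_const_add _ hA),
    area_apply hA,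
    hD.measure_set_eq (hD.vadd_of_comm a) (measurable_proj b hA)
      (fun g => by
        ext y
        have : proj b (g +ᵥ y) = proj b y := by
          rw [proj_eq_proj_iff]
          have : -(g +ᵥ y) + y = -(g : Plane) := by
            change -((g : Plane) + y) + y = _
            abel
          rw [this]
          exact neg_mem g.2
        simp [this])]
  have hpre : (fun y => a + y) ⁻¹' (proj b ⁻¹' A ∩ (a +ᵥ ZSpan.fundamentalDomain b))
      = proj b ⁻¹' ((fun x => proj b a + x) ⁻¹' A) ∩ ZSpan.fundamentalDomain b := by
    ext y
    simp only [Set.mem_preimage, Set.mem_inter_iff, proj_add]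
    refine and_congr_right fun _ => ?_
    change a +ᵥ y ∈ _ ↔ _
    exact Set.vadd_mem_vadd_set_iff
  rw [← hpre, measure_preimage_add]

theorem isProbabilityMeasure_area (hb : volume (ZSpan.fundamentalDomain b) = 1) :
    IsProbabilityMeasure (area b) :=
  ⟨by rw [area_univ, hb]⟩

instance isOpenPosMeasure_area [IsProbabilityMeasure (area b)] :
    (area b).IsOpenPosMeasure :=
  isOpenPosMeasure_of_addLeftInvariant_of_compact Set.univ isCompact_univ (by simp)

theorem Smooth.continuous {φ : FlatTorus b → ℝ} (hφ : Smooth φ) : Continuous φ :=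
  (isQuotientMap_proj b).continuous_iff.2 (ContDiff.continuous hφ)

theorem Smooth.contDiff {φ : FlatTorus b → ℝ} (hφ : Smooth φ) :
    ContDiff ℝ ∞ (fun y : Plane => φ (proj b y)) := hφ

theorem Smooth.mul {φ ψ : FlatTorus b → ℝ} (hφ : Smooth φ) (hψ : Smooth ψ) :
    Smooth (fun x => φ x * ψ x) :=
  ContDiff.mul hφ.contDiff hψ.contDiff

/-! ### Directional derivatives on the torus -/

/-- The derivative of `φ` in the direction `e`, read in the flat chart at `x`. -/
def dirDeriv (e : Plane) (φ : FlatTorus b → ℝ) (x : FlatTorus b) : ℝ :=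
  fderiv ℝ (fun y : Plane => φ (x + proj b y)) 0 e

theorem dirDeriv_proj (e : Plane) (φ : FlatTorus b → ℝ) (y : Plane) :
    dirDeriv e φ (proj b y) = fderiv ℝ (fun z : Plane => φ (proj b z)) y e := by
  have := fderiv_comp_add_left (𝕜 := ℝ) (f := fun z : Plane => φ (proj b z)) y (x := 0)
  rw [add_zero] at this
  rw [dirDeriv, ← this]
  rfl

theorem Smooth.dirDeriv {φ : FlatTorus b → ℝ} (hφ : Smooth φ) (e : Plane) :
    Smooth (dirDeriv e φ) := by
  have h : ContDiff ℝ ∞ (fun y => fderiv ℝ (fun z : Plane => φ (proj b z)) y e) :=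
    (hφ.contDiff.fderiv_right (m := ∞) (by simp)).clm_apply contDiff_const
  simpa only [Smooth, dirDeriv_proj] using h

theorem Smooth.differentiable {φ : FlatTorus b → ℝ} (hφ : Smooth φ) :
    Differentiable ℝ (fun y : Plane => φ (proj b y)) :=
  hφ.contDiff.differentiable (by simp)

theorem dirDeriv_mul {φ ψ : FlatTorus b → ℝ} (hφ : Smooth φ) (hψ : Smooth ψ) (e : Plane)
    (x : FlatTorus b) :
    dirDeriv e (fun x => φ x * ψ x) x = φ x * dirDeriv e ψ x + dirDeriv e φ x * ψ x := by
  obtain ⟨y, rfl⟩ := proj_surjective b x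
  simp only [dirDeriv_proj]
  rw [fderiv_fun_mul (hφ.differentiable y) (hψ.differentiable y)]
  simp [mul_comm]

theorem laplacian_eq_sum {φ : FlatTorus b → ℝ} (hφ : Smooth φ) (x : FlatTorus b) :
    laplacian φ x = ∑ i, dirDeriv (EuclideanSpace.basisFun (Fin 2) ℝ i)
      (dirDeriv (EuclideanSpace.basisFun (Fin 2) ℝ i) φ) x := by
  obtain ⟨y, rfl⟩ := proj_surjective b x
  rw [laplacian, InnerProductSpace.laplacian_eq_iteratedFDeriv_orthonormalBasis _
    (EuclideanSpace.basisFun (Fin 2) ℝ)]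
  refine Finset.sum_congr rfl fun i _ => ?_
  have := iteratedFDeriv_comp_add_left (𝕜 := ℝ) (f := fun z : Plane => φ (proj b z)) 2 y 0
  rw [add_zero] at this
  have h2 : (fun z : Plane => φ (proj b y + proj b z)) = fun z => φ (proj b (y + z)) := rfl
  rw [h2, this, iteratedFDeriv_two_apply, dirDeriv_proj]
  simp only [dirDeriv_proj]
  rw [fderiv_clm_apply (hφ.contDiff.fderiv_right (m := ∞) (by simp) |>.differentiable (by simp) y)
    (differentiableAt_const _)]
  simp

theorem Smooth.continuous_laplacian {φ : FlatTorus b → ℝ} (hφ : Smooth φ) :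
    Continuous (FlatTorus.laplacian φ) := by
  rw [funext (laplacian_eq_sum hφ)]
  exact continuous_finsetSum _ fun i _ => ((hφ.dirDeriv _).dirDeriv _).continuous

/-! ### Integration by parts -/

section Integral

variable [IsProbabilityMeasure (area b)]

theorem integrable_of_continuous {f : FlatTorus b → ℝ} (hf : Continuous f) :
    Integrable f (area b) := by
  exact hf.integrable_of_hasCompactSupport (HasCompactSupport.of_compactSpace f)

/-- The derivative integrated along the segment from x to x + e is φ(x + e) - φ(x), whose integral
over x vanishes by translation invariance. Fubini and invariance again identify the other side; no
boundary terms arise. -/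
theorem integral_dirDeriv {φ : FlatTorus b → ℝ} (hφ : Smooth φ) (e : Plane) :
    ∫ x, dirDeriv e φ x ∂(area b) = 0 := by
  have hline : ∀ x : FlatTorus b,
      ∫ t in (0 : ℝ)..1, dirDeriv e φ (x + proj b (t • e)) = φ (x + proj b e) - φ x := by
    intro x
    obtain ⟨y, rfl⟩ := proj_surjective b x
    have hd : ∀ t : ℝ, HasDerivAt (fun t : ℝ => φ (proj b (y + t • e)))
        (dirDeriv e φ (proj b y + proj b (t • e))) t := by
      intro t
      rw [← proj_add, dirDeriv_proj]
      have h1 : HasDerivAt (fun t : ℝ => y + t • e) e t := by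
        simpa using ((hasDerivAt_id t).smul_const e).const_add y
      exact (hφ.differentiable (y + t • e)).hasFDerivAt.comp_hasDerivAt t h1
    rw [intervalIntegral.integral_eq_sub_of_hasDerivAt (fun t _ => hd t)]
    · simp [proj_add]
    · refine Continuous.intervalIntegrable ?_ _ _
      exact (hφ.dirDeriv e).continuous.comp
        (continuous_const.add ((continuous_proj b).comp (continuous_id.smul continuous_const)))
  have hcont : Continuous fun z : FlatTorus b × ℝ => dirDeriv e φ (z.1 + proj b (z.2 • e)) :=
    (hφ.dirDeriv e).continuous.comp
      (continuous_fst.add ((continuous_proj b).comp (continuous_snd.smul continuous_const)))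
  obtain ⟨C, hC⟩ := (isCompact_univ.exists_bound_of_continuousOn
    (hφ.dirDeriv e).continuous.continuousOn)
  have hint : Integrable (Function.uncurry fun (x : FlatTorus b) (t : ℝ) =>
      dirDeriv e φ (x + proj b (t • e))) ((area b).prod (volume.restrict (Set.uIoc 0 1))) := by
    rw [Set.uIoc_of_le zero_le_one]
    refine Integrable.of_bound hcont.aestronglyMeasurable C (Filter.Eventually.of_forall fun z => ?_)
    exact hC _ (Set.mem_univ _)
  have hswap := integral_integral_swap hint
  have h0 : ∫ x, (φ (x + proj b e) - φ x) ∂(area b) = 0 := by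
    have h1 : Integrable (fun x => φ (x + proj b e)) (area b) :=
      integrable_of_continuous (hφ.continuous.comp (continuous_add_const _))
    rw [integral_sub h1 (integrable_of_continuous hφ.continuous), integral_add_right_eq_self,
      sub_self]
  rw [← h0]
  simp_rw [← hline, intervalIntegral.integral_of_le zero_le_one]
  rw [Set.uIoc_of_le zero_le_one] at hswap
  rw [hswap]
  simp [integral_add_right_eq_self (fun x => dirDeriv e φ x)]

theorem integral_dirDeriv_mul {φ ψ : FlatTorus b → ℝ} (hφ : Smooth φ) (hψ : Smooth ψ)
    (e : Plane) :
    ∫ x, dirDeriv e φ x * ψ x ∂(area b) = -∫ x, φ x * dirDeriv e ψ x ∂(area b) := by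
  have h := integral_dirDeriv (hφ.mul hψ) e
  simp_rw [dirDeriv_mul hφ hψ] at h
  rw [integral_add (f := fun x => φ x * dirDeriv e ψ x)
    (g := fun x => dirDeriv e φ x * ψ x) (integrable_of_continuous (hφ.continuous.mul (hψ.dirDeriv e).continuous))
    (integrable_of_continuous ((hφ.dirDeriv e).continuous.mul hψ.continuous))] at h
  linarith

theorem integral_laplacian_mul {φ ψ : FlatTorus b → ℝ} (hφ : Smooth φ) (hψ : Smooth ψ) :
    ∫ x, laplacian φ x * ψ x ∂(area b) = ∫ x, φ x * laplacian ψ x ∂(area b) := by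
  simp_rw [laplacian_eq_sum hφ, laplacian_eq_sum hψ, Finset.sum_mul, Finset.mul_sum]
  rw [integral_finsetSum, integral_finsetSum]
  rotate_left
  · exact fun i _ => integrable_of_continuous
      (hφ.continuous.mul ((hψ.dirDeriv _).dirDeriv _).continuous)
  · exact fun i _ => integrable_of_continuous
      (((hφ.dirDeriv _).dirDeriv _).continuous.mul hψ.continuous)
  refine Finset.sum_congr rfl fun i _ => ?_
  rw [integral_dirDeriv_mul (hφ.dirDeriv _) hψ,
    ← neg_neg (∫ x, φ x * _ ∂(area b)), ← integral_dirDeriv_mul hφ (hψ.dirDeriv _)]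

end Integral

/-! ### Plane waves on the torus and uniqueness of Fourier coefficients -/

/-- The linear form `y ↦ 2π ∑ᵢ mᵢ yᵢ`, with `yᵢ` the coordinates of `y` in the basis `b`. -/
def phase (b : Module.Basis (Fin 2) ℝ Plane) (m : Fin 2 → ℤ) : Plane →L[ℝ] ℝ :=
  LinearMap.toContinuousLinearMap (∑ i, (2 * Real.pi * m i) • b.coord i)

theorem phase_apply (m : Fin 2 → ℤ) (y : Plane) :
    phase b m y = ∑ i, 2 * Real.pi * m i * b.repr y i := by
  simp [phase]

theorem phase_add_index (m n : Fin 2 → ℤ) (y : Plane) :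
    phase b (m + n) y = phase b m y + phase b n y := by
  simp [phase_apply, Fin.sum_univ_two]; ring

theorem phase_sub_index (m n : Fin 2 → ℤ) (y : Plane) :
    phase b (m - n) y = phase b m y - phase b n y := by
  simp [phase_apply, Fin.sum_univ_two]; ring

theorem exists_phase_lattice (m : Fin 2 → ℤ) {y : Plane}
    (hy : y ∈ Submodule.span ℤ (Set.range b)) : ∃ k : ℤ, phase b m y = k * (2 * Real.pi) := by
  have h : ∀ i, ∃ k : ℤ, b.repr y i = k := fun i => by
    obtain ⟨k, hk⟩ := (b.mem_span_iff_repr_mem ℤ y).1 hy i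
    exact ⟨k, by simpa using hk.symm⟩
  choose k hk using h
  refine ⟨∑ i, m i * k i, ?_⟩
  rw [phase_apply]
  push_cast
  rw [Finset.sum_mul]
  refine Finset.sum_congr rfl fun i _ => ?_
  rw [hk]; ring

/-- The plane wave `y ↦ cos (phase y - a)`, as a function on the torus. -/
def wave (b : Module.Basis (Fin 2) ℝ Plane) (m : Fin 2 → ℤ) (a : ℝ) (x : FlatTorus b) : ℝ :=
  Real.cos (phase b m (Quotient.out x) - a)

theorem wave_proj (m : Fin 2 → ℤ) (a : ℝ) (y : Plane) :
    wave b m a (proj b y) = Real.cos (phase b m y - a) := by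
  have h : proj b (Quotient.out (proj b y)) = proj b y := Quotient.out_eq _
  obtain ⟨k, hk⟩ := exists_phase_lattice m (proj_eq_proj_iff.1 h)
  have h2 : phase b m y - a
      = phase b m (Quotient.out (proj b y)) - a + k * (2 * Real.pi) := by
    rw [← hk, map_add, map_neg]; ring
  rw [h2, Real.cos_add_int_mul_two_pi, wave]

theorem smooth_wave (m : Fin 2 → ℤ) (a : ℝ) : Smooth (wave b m a) := by
  have : ContDiff ℝ ∞ fun y : Plane => Real.cos (phase b m y - a) :=
    Real.contDiff_cos.comp ((phase b m).contDiff.sub contDiff_const)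
  simpa only [Smooth, wave_proj] using this

/-- Shifting a by π/2 exchanges cosine and sine, so the two waves of one index span a
translation-invariant plane. -/
theorem wave_add (m : Fin 2 → ℤ) (a : ℝ) (x : FlatTorus b) (y : Plane) :
    wave b m a (x + proj b y)
      = Real.cos (phase b m y) * wave b m a x
        + Real.sin (phase b m y) * wave b m (a - Real.pi / 2) x := by
  obtain ⟨z, rfl⟩ := proj_surjective b x
  rw [← proj_add, wave_proj, wave_proj, wave_proj, map_add]
  have h1 : phase b m z + phase b m y - a = (phase b m z - a) + phase b m y := by ring
  have h2 : phase b m z - (a - Real.pi / 2) = (phase b m z - a) + Real.pi / 2 := by ring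
  rw [h1, h2, Real.cos_add, Real.cos_add_pi_div_two]
  ring

theorem abs_wave_le_one (m : Fin 2 → ℤ) (a : ℝ) (x : FlatTorus b) : |wave b m a x| ≤ 1 :=
  Real.abs_cos_le_one _

theorem dirDeriv_wave (m : Fin 2 → ℤ) (a : ℝ) (e : Plane) (x : FlatTorus b) :
    dirDeriv e (wave b m a) x = phase b m e * wave b m (a - Real.pi / 2) x := by
  obtain ⟨y, rfl⟩ := proj_surjective b x
  rw [dirDeriv_proj]
  simp only [wave_proj]
  have h : HasFDerivAt (fun z : Plane => Real.cos (phase b m z - a))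
      (-Real.sin (phase b m y - a) • phase b m) y :=
    ((phase b m).hasFDerivAt.sub_const a).cos
  have h2 : phase b m y - (a - Real.pi / 2) = (phase b m y - a) + Real.pi / 2 := by ring
  rw [h.fderiv, h2, Real.cos_add_pi_div_two]
  simp [mul_comm]

/-- The eigenvalue `|ξ|²` of `-Δ` on the plane waves of index `m`. -/
def freqSq (b : Module.Basis (Fin 2) ℝ Plane) (m : Fin 2 → ℤ) : ℝ :=
  ∑ i, phase b m (EuclideanSpace.basisFun (Fin 2) ℝ i) ^ 2

theorem freqSq_nonneg (m : Fin 2 → ℤ) : 0 ≤ freqSq b m :=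
  Finset.sum_nonneg fun _ _ => sq_nonneg _

theorem laplacian_wave (m : Fin 2 → ℤ) (a : ℝ) (x : FlatTorus b) :
    laplacian (wave b m a) x = -freqSq b m * wave b m a x := by
  have hd : ∀ (c : ℝ) (e : Plane), dirDeriv e (fun x => c * wave b m (a - Real.pi / 2) x) x
      = c * dirDeriv e (wave b m (a - Real.pi / 2)) x := fun c e => by
    obtain ⟨y, rfl⟩ := proj_surjective b x
    rw [dirDeriv_proj, dirDeriv_proj, fderiv_const_mul ((smooth_wave _ _).differentiable y)]
    simp
  obtain ⟨y, rfl⟩ := proj_surjective b x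
  have h2 : phase b m y - (a - Real.pi / 2 - Real.pi / 2) = (phase b m y - a) + Real.pi := by
    ring
  rw [laplacian_eq_sum (smooth_wave m a), freqSq, ← Finset.sum_neg_distrib, Finset.sum_mul]
  refine Finset.sum_congr rfl fun i _ => ?_
  rw [funext (dirDeriv_wave m a _), hd, dirDeriv_wave, wave_proj, wave_proj, h2, Real.cos_add_pi]
  ring

/-- The span of the plane waves in the continuous functions. -/
def waveSpan (b : Module.Basis (Fin 2) ℝ Plane) : Submodule ℝ C(FlatTorus b, ℝ) :=
  Submodule.span ℝ (Set.range fun q : (Fin 2 → ℤ) × ℝ =>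
    (⟨wave b q.1 q.2, (smooth_wave q.1 q.2).continuous⟩ : C(FlatTorus b, ℝ)))

theorem wave_mem_waveSpan (m : Fin 2 → ℤ) (a : ℝ) :
    (⟨wave b m a, (smooth_wave m a).continuous⟩ : C(FlatTorus b, ℝ)) ∈ waveSpan b :=
  Submodule.subset_span ⟨(m, a), rfl⟩

theorem one_mem_waveSpan : (1 : C(FlatTorus b, ℝ)) ∈ waveSpan b := by
  convert wave_mem_waveSpan (b := b) 0 0 using 1
  ext x
  simp [wave, phase_apply]

/-- The product-to-sum formula for cosines makes the span an algebra. -/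
theorem mul_mem_waveSpan {f g : C(FlatTorus b, ℝ)} (hf : f ∈ waveSpan b) (hg : g ∈ waveSpan b) :
    f * g ∈ waveSpan b := by
  have hww : ∀ (m n : Fin 2 → ℤ) (a c : ℝ),
      (⟨wave b m a, (smooth_wave m a).continuous⟩ : C(FlatTorus b, ℝ))
        * ⟨wave b n c, (smooth_wave n c).continuous⟩ ∈ waveSpan b := by
    intro m n a c
    have : (⟨wave b m a, (smooth_wave m a).continuous⟩ : C(FlatTorus b, ℝ))
        * ⟨wave b n c, (smooth_wave n c).continuous⟩
        = (1 / 2 : ℝ) • (⟨wave b (m + n) (a + c), (smooth_wave _ _).continuous⟩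
          + ⟨wave b (m - n) (a - c), (smooth_wave _ _).continuous⟩ : C(FlatTorus b, ℝ)) := by
      ext x
      simp only [wave, ContinuousMap.mul_apply, ContinuousMap.coe_mk, ContinuousMap.smul_apply,
        ContinuousMap.add_apply, phase_add_index, phase_sub_index, smul_eq_mul]
      generalize phase b m (Quotient.out x) = u
      generalize phase b n (Quotient.out x) = v
      have h1 : u + v - (a + c) = (u - a) + (v - c) := by ring
      have h2 : u - v - (a - c) = (u - a) - (v - c) := by ring
      rw [h1, h2, Real.cos_add (u - a), Real.cos_sub (u - a)]
      ring
    rw [this]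
    exact Submodule.smul_mem _ _ (add_mem (wave_mem_waveSpan _ _) (wave_mem_waveSpan _ _))
  induction hf using Submodule.span_induction with
  | mem f hf =>
    obtain ⟨⟨m, a⟩, rfl⟩ := hf
    induction hg using Submodule.span_induction with
    | mem g hg =>
      obtain ⟨⟨n, c⟩, rfl⟩ := hg
      exact hww m n a c
    | zero => simp
    | add g₁ g₂ _ _ h₁ h₂ => rw [mul_add]; exact add_mem h₁ h₂
    | smul r g _ h => rw [mul_smul_comm]; exact Submodule.smul_mem _ _ h
  | zero => simp
  | add f₁ f₂ _ _ h₁ h₂ => rw [add_mul]; exact add_mem h₁ h₂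
  | smul r f _ h => rw [smul_mul_assoc]; exact Submodule.smul_mem _ _ h

theorem eq_of_forall_wave_eq {x y : FlatTorus b} (h : ∀ m a, wave b m a x = wave b m a y) :
    x = y := by
  obtain ⟨x, rfl⟩ := proj_surjective b x
  obtain ⟨y, rfl⟩ := proj_surjective b y
  rw [proj_eq_proj_iff, b.mem_span_iff_repr_mem ℤ]
  intro i
  -- With this shift the wave equals 1 at x, so its value at y forces the i-th coordinates to differ
  -- by an integer.
  have h1 := h (Pi.single i 1) (phase b (Pi.single i 1) x)
  rw [wave_proj, wave_proj, sub_self, Real.cos_zero] at h1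
  obtain ⟨k, hk⟩ := (Real.cos_eq_one_iff _).1 h1.symm
  refine ⟨k, ?_⟩
  have hp : ∀ z : Plane, phase b (Pi.single i 1) z = 2 * Real.pi * b.repr z i := fun z => by
    rw [phase_apply, Finset.sum_eq_single i] <;> simp +contextual
  rw [hp, hp] at hk
  have : (k : ℝ) = b.repr y i - b.repr x i := by
    have hpi := Real.two_pi_pos.ne'
    apply mul_right_cancel₀ hpi
    linarith
  simp [this]
  ring

/-- Stone–Weierstrass on the compact torus. -/
theorem waveSpan_topologicalClosure : (waveSpan b).topologicalClosure = ⊤ := by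
  let A : Subalgebra ℝ C(FlatTorus b, ℝ) :=
    (waveSpan b).toSubalgebra one_mem_waveSpan fun _ _ => mul_mem_waveSpan
  have hA : A.SeparatesPoints := by
    intro x y hxy
    by_contra! hc
    refine hxy (eq_of_forall_wave_eq fun m a => ?_)
    exact hc _ ⟨⟨wave b m a, (smooth_wave m a).continuous⟩, wave_mem_waveSpan m a, rfl⟩
  have h := ContinuousMap.subalgebra_topologicalClosure_eq_top_of_separatesPoints A hA
  rw [eq_top_iff]
  intro f _
  have : f ∈ A.topologicalClosure := by rw [h]; trivial
  exact this

/-- An integrable function on the torus whose Fourier coefficients vanish is zero. -/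
theorem ae_eq_zero_of_integral_wave_eq_zero {f : FlatTorus b → ℝ} (hf : Integrable f (area b))
    (h : ∀ m a, ∫ x, f x * wave b m a x ∂(area b) = 0) : f =ᵐ[area b] 0 := by
  have hint : ∀ g : C(FlatTorus b, ℝ), Integrable (fun x => f x * g x) (area b) := fun g =>
    hf.mul_bdd (c := ‖g‖) g.continuous.aestronglyMeasurable
      (Filter.Eventually.of_forall g.norm_coe_le_norm)
  let T : C(FlatTorus b, ℝ) →ₗ[ℝ] ℝ :=
    { toFun := fun g => ∫ x, f x * g x ∂(area b)
      map_add' := fun g₁ g₂ => by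
        simp only [ContinuousMap.add_apply, mul_add]
        exact integral_add (hint g₁) (hint g₂)
      map_smul' := fun r g => by
        simp only [ContinuousMap.smul_apply, smul_eq_mul, RingHom.id_apply]
        rw [← integral_const_mul]
        congr 1; ext x; ring }
  -- Integration against f is bounded in the sup norm, so its kernel is closed and, containing all
  -- waves, is everything.
  have hTb : ∀ g, ‖T g‖ ≤ (∫ x, ‖f x‖ ∂(area b)) * ‖g‖ := by
    intro g
    refine (norm_integral_le_integral_norm _).trans ?_
    rw [← integral_mul_const]
    refine integral_mono (hint g).norm (hf.norm.mul_const _) fun x => ?_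
    rw [norm_mul]
    exact mul_le_mul_of_nonneg_left (g.norm_coe_le_norm x) (norm_nonneg _)
  let T' := T.mkContinuous _ hTb
  have hker : IsClosed (LinearMap.ker T : Set C(FlatTorus b, ℝ)) :=
    T'.isClosed_ker
  have hle : waveSpan b ≤ LinearMap.ker T := by
    rw [waveSpan, Submodule.span_le]
    rintro _ ⟨⟨m, a⟩, rfl⟩
    exact h m a
  have hall : ∀ g : C(FlatTorus b, ℝ), ∫ x, f x * g x ∂(area b) = 0 := by
    intro g
    have := Submodule.topologicalClosure_minimal _ hle hker
    rw [waveSpan_topologicalClosure] at this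
    exact this (Submodule.mem_top (x := g))
  -- The positive and negative parts of f define finite measures with equal integrals of continuous
  -- functions. They coincide, so f⁺ = f⁻ almost everywhere.
  set μ₁ := (area b).withDensity fun x => ENNReal.ofReal (f x)
  set μ₂ := (area b).withDensity fun x => ENNReal.ofReal (-f x)
  have hfin : ∀ g : FlatTorus b → ℝ, Integrable g (area b) →
      IsFiniteMeasure ((area b).withDensity fun x => ENNReal.ofReal (g x)) := fun g hg =>
    isFiniteMeasure_withDensity_ofReal hg.2
  have hneg : Integrable (fun x => -f x) (area b) := hf.neg
  have := hfin f hf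
  have := hfin _ hneg
  have hμ : μ₁ = μ₂ := by
    refine ext_of_forall_integral_eq_of_IsFiniteMeasure fun g => ?_
    have hm : ∀ g : FlatTorus b → ℝ, Integrable g (area b) →
        AEMeasurable (fun x => ENNReal.ofReal (g x)) (area b) := fun g hg =>
      hg.aestronglyMeasurable.aemeasurable.ennreal_ofReal
    rw [integral_withDensity_eq_integral_toReal_smul₀ (hm f hf) (by simp),
      integral_withDensity_eq_integral_toReal_smul₀ (hm _ hneg) (by simp), ← sub_eq_zero,
      ← integral_sub]
    · rw [← hall ⟨g, g.continuous⟩]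
      congr 1; ext x
      simp only [ENNReal.toReal_ofReal', smul_eq_mul, ContinuousMap.coe_mk, ← sub_mul]
      rw [max_zero_sub_eq_self]
    · have := (hf.pos_part).mul_bdd (c := ‖g‖) g.continuous.aestronglyMeasurable
        (Filter.Eventually.of_forall g.norm_coe_le_norm)
      simpa [ENNReal.toReal_ofReal'] using this
    · have := (hf.neg_part).mul_bdd (c := ‖g‖) g.continuous.aestronglyMeasurable
        (Filter.Eventually.of_forall g.norm_coe_le_norm)
      simpa [ENNReal.toReal_ofReal'] using this
  have hae := (withDensity_eq_iff hf.aestronglyMeasurable.aemeasurable.ennreal_ofReal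
    hneg.aestronglyMeasurable.aemeasurable.ennreal_ofReal
    (by
      have := (hfin f hf).measure_univ_lt_top
      rw [withDensity_apply _ MeasurableSet.univ, Measure.restrict_univ] at this
      exact this.ne)).1 hμ
  filter_upwards [hae] with x hx
  rcases le_total 0 (f x) with h0 | h0
  · rw [ENNReal.ofReal_of_nonpos (p := -f x) (by linarith), ENNReal.ofReal_eq_zero] at hx
    exact le_antisymm hx h0
  · rw [ENNReal.ofReal_of_nonpos h0, eq_comm, ENNReal.ofReal_eq_zero] at hx
    exact le_antisymm h0 (by simpa using hx)

theorem ae_eq_of_integral_wave_eq {f g : FlatTorus b → ℝ} (hf : Integrable f (area b))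
    (hg : Integrable g (area b))
    (h : ∀ m a, ∫ x, f x * wave b m a x ∂(area b) = ∫ x, g x * wave b m a x ∂(area b)) :
    f =ᵐ[area b] g := by
  have hw : ∀ {f : FlatTorus b → ℝ}, Integrable f (area b) → ∀ m a,
      Integrable (fun x => f x * wave b m a x) (area b) := fun hf m a =>
    hf.mul_bdd (c := 1) (smooth_wave m a).continuous.aestronglyMeasurable
      (Filter.Eventually.of_forall (abs_wave_le_one m a))
  have := ae_eq_zero_of_integral_wave_eq_zero (hf.sub hg) fun m a => by
    simp only [Pi.sub_apply, sub_mul]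
    rw [integral_sub (hw hf m a) (hw hg m a), h, sub_self]
  filter_upwards [this] with x hx
  exact sub_eq_zero.1 hx

end FlatTorus

/-! ### Averaging operators on a measurable group -/

section Averaging

open scoped ENNReal

variable {X : Type*} [MeasurableSpace X]

/-- The average of `f` over the translates by `y`, weighted by `κ`. -/
def avg [Add X] (κ : Measure X) (f : X → ℝ) (x : X) : ℝ := ∫ y, f (x + y) ∂κ

/-- The average of a nonnegative function over the translates by `y`, weighted by `κ`. -/
def lavg [Add X] (κ : Measure X) (f : X → ℝ≥0∞) (x : X) : ℝ≥0∞ := ∫⁻ y, f (x + y) ∂κ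

variable [AddCommGroup X] [MeasurableAdd₂ X] [MeasurableNeg X] {μ κ : Measure X}

theorem measurable_lavg [SFinite κ] {f : X → ℝ≥0∞} (hf : Measurable f) :
    Measurable (lavg κ f) :=
  (hf.comp measurable_add).lintegral_prod_right'

theorem lavg_tsum {f : ℕ → X → ℝ≥0∞} (hf : ∀ n, Measurable (f n)) (x : X) :
    lavg κ (fun x => ∑' n, f n x) x = ∑' n, lavg κ (f n) x :=
  lintegral_tsum fun n => ((hf n).comp (measurable_const_add x)).aemeasurable

theorem lavg_mono {f g : X → ℝ≥0∞} (h : ∀ x, f x ≤ g x) (x : X) : lavg κ f x ≤ lavg κ g x :=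
  lintegral_mono fun _ => h _

theorem lavg_const (C : ℝ≥0∞) (x : X) : lavg κ (fun _ => C) x = C * κ Set.univ := by
  simp [lavg]

theorem lavg_smul_left [μ.IsAddLeftInvariant] (c : ℝ≥0∞) (f : X → ℝ≥0∞) (x : X) :
    lavg (c • μ) f x = c * ∫⁻ y, f y ∂μ := by
  rw [lavg, lintegral_smul_measure, lintegral_add_left_eq_self, smul_eq_mul]

theorem lintegral_lavg [SFinite μ] [μ.IsAddLeftInvariant] [SFinite κ] {f : X → ℝ≥0∞}
    (hf : Measurable f) : ∫⁻ x, lavg κ f x ∂μ = (∫⁻ x, f x ∂μ) * κ Set.univ := by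
  simp only [lavg]
  rw [lintegral_lintegral_swap (f := fun x y => f (x + y)) (hf.comp measurable_add).aemeasurable]
  simp [lintegral_add_right_eq_self]

/-- Valid at every x, not merely almost every x: null sets do not affect averages pointwise. -/
theorem ae_translate [SFinite μ] [μ.IsAddLeftInvariant] (hκ : κ ≪ μ) {P : X → Prop} (h : ∀ᵐ x ∂μ, P x)
    (x : X) : ∀ᵐ y ∂κ, P (x + y) :=
  hκ.ae_le ((quasiMeasurePreserving_add_left μ x).ae h)

theorem lavg_mono_ae [SFinite μ] [μ.IsAddLeftInvariant] (hκ : κ ≪ μ) {f g : X → ℝ≥0∞} (h : f ≤ᵐ[μ] g)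
    (x : X) : lavg κ f x ≤ lavg κ g x :=
  lintegral_mono_ae (ae_translate hκ h x)

theorem lavg_congr_ae [SFinite μ] [μ.IsAddLeftInvariant] (hκ : κ ≪ μ) {f g : X → ℝ≥0∞} (h : f =ᵐ[μ] g)
    (x : X) : lavg κ f x = lavg κ g x :=
  lintegral_congr_ae (ae_translate hκ h x)

theorem avg_congr_ae [SFinite μ] [μ.IsAddLeftInvariant] (hκ : κ ≪ μ) {f g : X → ℝ} (h : f =ᵐ[μ] g)
    (x : X) : avg κ f x = avg κ g x :=
  integral_congr_ae (ae_translate hκ h x)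

/-- The density of the translate of `κ` to `p`. -/
def source (κ μ : Measure X) (p x : X) : ℝ≥0∞ := κ.rnDeriv μ (x - p)

theorem measurable_source [MeasurableSub₂ X] (p : X) : Measurable (source κ μ p) :=
  (Measure.measurable_rnDeriv κ μ).comp (measurable_sub_const p)

/-! ### Averages of integrable functions and their adjoints -/

section Probability

variable [IsProbabilityMeasure μ] [μ.IsAddLeftInvariant] [IsProbabilityMeasure κ]

/-- This makes (x, y) ↦ f(x + y) integrable on the product, so that averages of L¹ functions exist
almost everywhere and Fubini applies. -/
theorem measurePreserving_add_prod :
    MeasurePreserving (fun z : X × X => z.1 + z.2) (μ.prod κ) μ := by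
  refine ⟨measurable_add, ?_⟩
  ext A hA
  rw [Measure.map_apply measurable_add hA, Measure.prod_apply_symm (measurable_add hA)]
  have : ∀ y, μ ((fun x => (x, y)) ⁻¹' ((fun z : X × X => z.1 + z.2) ⁻¹' A)) = μ A := fun y =>
    measure_preimage_add_right μ y A
  simp [this]

theorem integrable_comp_add {f : X → ℝ} (hf : Integrable f μ) :
    Integrable (fun z : X × X => f (z.1 + z.2)) (μ.prod κ) :=
  measurePreserving_add_prod.integrable_comp_of_integrable hf

theorem integrable_avg {f : X → ℝ} (hf : Integrable f μ) : Integrable (avg κ f) μ :=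
  (integrable_comp_add hf).integral_prod_left

theorem ae_integrable_translate {f : X → ℝ} (hf : Integrable f μ) :
    ∀ᵐ x ∂μ, Integrable (fun y => f (x + y)) κ :=
  (integrable_comp_add hf).prod_right_ae

theorem avg_add_ae {f g : X → ℝ} (hf : Integrable f μ) (hg : Integrable g μ) :
    avg κ (fun x => f x + g x) =ᵐ[μ] fun x => avg κ f x + avg κ g x := by
  filter_upwards [ae_integrable_translate (κ := κ) hf, ae_integrable_translate (κ := κ) hg]
    with x h1 h2
  exact integral_add h1 h2

theorem avg_sub_ae {f g : X → ℝ} (hf : Integrable f μ) (hg : Integrable g μ) :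
    avg κ (fun x => f x - g x) =ᵐ[μ] fun x => avg κ f x - avg κ g x := by
  filter_upwards [ae_integrable_translate (κ := κ) hf, ae_integrable_translate (κ := κ) hg]
    with x h1 h2
  exact integral_sub h1 h2

theorem avg_const (C : ℝ) (x : X) : avg κ (fun _ => C) x = C := by
  simp [avg]

theorem ofReal_avg_ae (hκ : κ ≪ μ) {f : X → ℝ} (hf : Integrable f μ) (h0 : ∀ᵐ x ∂μ, 0 ≤ f x) :
    ∀ᵐ x ∂μ, ENNReal.ofReal (avg κ f x) = lavg κ (fun x => ENNReal.ofReal (f x)) x := by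
  filter_upwards [ae_integrable_translate (κ := κ) hf] with x hx
  exact ofReal_integral_eq_lintegral_ofReal hx (ae_translate hκ h0 x)

theorem avg_toReal (hκ : κ ≪ μ) {f : X → ℝ≥0∞} (hf : Measurable f) (h : ∀ᵐ x ∂μ, f x < ⊤)
    (x : X) : avg κ (fun x => (f x).toReal) x = (lavg κ f x).toReal :=
  integral_toReal (hf.comp (measurable_const_add x)).aemeasurable (ae_translate hκ h x)

/-- Self-adjointness: substitute x ↦ x - y, then use the symmetry of κ to replace -y by y. -/
theorem integral_avg_mul (hs : κ.map Neg.neg = κ) {f φ : X → ℝ}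
    (hf : Integrable f μ) (hφ : Measurable φ) {C : ℝ} (hC : ∀ x, |φ x| ≤ C) :
    ∫ x, avg κ f x * φ x ∂μ = ∫ x, f x * avg κ φ x ∂μ := by
  have h1 : Integrable (Function.uncurry fun x y => f (x + y) * φ x) (μ.prod κ) :=
    (integrable_comp_add hf).mul_bdd (c := C) (hφ.comp measurable_fst).aestronglyMeasurable
      (Filter.Eventually.of_forall fun z => hC z.1)
  have h2 : Integrable (Function.uncurry fun x y => f x * φ (x + y)) (μ.prod κ) :=
    (hf.comp_fst κ).mul_bdd (c := C) (hφ.comp measurable_add).aestronglyMeasurable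
      (Filter.Eventually.of_forall fun z => hC (z.1 + z.2))
  have e1 : ∀ y, ∫ x, f (x + y) * φ x ∂μ = ∫ x, f x * φ (x + -y) ∂μ := fun y => by
    rw [← integral_add_right_eq_self (fun x => f x * φ (x + -y)) y]
    simp
  simp only [avg, ← integral_mul_const, ← integral_const_mul]
  rw [integral_integral_swap h1, integral_integral_swap h2]
  simp_rw [e1]
  have hm : AEStronglyMeasurable (fun y => ∫ x, f x * φ (x + y) ∂μ) (κ.map Neg.neg) := by
    rw [hs]
    exact h2.integral_prod_right.aestronglyMeasurable
  rw [← integral_map measurable_neg.aemeasurable hm, hs]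

theorem lintegral_source (hκ : κ ≪ μ) (p : X) :
    ∫⁻ x, source κ μ p x ∂μ = 1 := by
  simp only [source, sub_eq_add_neg]
  rw [lintegral_add_right_eq_self (fun x => κ.rnDeriv μ x) (-p), Measure.lintegral_rnDeriv hκ]
  simp

/-- Translation by p moves the density back to the origin. The source thus plays the role of the
average of δ_p. -/
theorem integral_source_mul (hκ : κ ≪ μ) (p : X) (φ : X → ℝ) :
    ∫ x, (source κ μ p x).toReal * φ x ∂μ = avg κ φ p := by
  rw [← integral_add_right_eq_self _ p]
  simp only [source, add_sub_cancel_right]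
  rw [avg, ← integral_rnDeriv_smul hκ]
  simp [add_comm]

end Probability

/-! ### Resolvent of a sub-Markov averaging operator -/

section Resolvent

/-- The Neumann series `∑ₙ (lavg q)ⁿ f`. -/
def neumann (q : Measure X) (f : X → ℝ≥0∞) (x : X) : ℝ≥0∞ := ∑' n, (lavg q)^[n] f x

variable {q : Measure X} [SFinite q] {f : X → ℝ≥0∞}

theorem measurable_lavg_iterate (hf : Measurable f) (n : ℕ) : Measurable ((lavg q)^[n] f) := by
  induction n with
  | zero => exact hf
  | succ n ih => rw [Function.iterate_succ_apply']; exact measurable_lavg ih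

theorem measurable_neumann (hf : Measurable f) : Measurable (neumann q f) :=
  Measurable.tsum fun n => measurable_lavg_iterate hf n

theorem neumann_eq (hf : Measurable f) (x : X) :
    neumann q f x = f x + lavg q (neumann q f) x := by
  have h : lavg q (neumann q f) x = ∑' n, (lavg q)^[n + 1] f x := by
    simp only [Function.iterate_succ_apply']
    exact lavg_tsum (fun n => measurable_lavg_iterate hf n) x
  rw [h, neumann, tsum_eq_zero_add' ENNReal.summable]
  rfl

/-- Each application of the kernel multiplies the integral by its mass; the geometric series is
summed. -/
theorem lintegral_neumann [SFinite μ] [μ.IsAddLeftInvariant] (hf : Measurable f) :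
    ∫⁻ x, neumann q f x ∂μ = (∫⁻ x, f x ∂μ) * (1 - q Set.univ)⁻¹ := by
  have h : ∀ n, ∫⁻ x, (lavg q)^[n] f x ∂μ = (∫⁻ x, f x ∂μ) * q Set.univ ^ n := by
    intro n
    induction n with
    | zero => simp
    | succ n ih =>
      rw [Function.iterate_succ_apply', lintegral_lavg (measurable_lavg_iterate hf n), ih,
        pow_succ, mul_assoc]
  simp only [neumann]
  rw [lintegral_tsum fun n => (measurable_lavg_iterate hf n).aemeasurable]
  simp_rw [h]
  rw [ENNReal.tsum_mul_left, ENNReal.tsum_geometric]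

theorem neumann_le {A : ℝ≥0∞} (hf : ∀ x, f x ≤ A) (x : X) :
    neumann q f x ≤ A * (1 - q Set.univ)⁻¹ := by
  have h : ∀ n x, (lavg q)^[n] f x ≤ A * q Set.univ ^ n := by
    intro n
    induction n with
    | zero => simpa using hf
    | succ n ih =>
      intro x
      rw [Function.iterate_succ_apply', pow_succ, ← mul_assoc]
      exact (lavg_mono ih x).trans (lavg_const _ x).le
  refine (ENNReal.tsum_le_tsum fun n => h n x).trans ?_
  rw [ENNReal.tsum_mul_left, ENNReal.tsum_geometric]

/-- If `κ` dominates `c • μ`, the Neumann series of the remainder `κ - c • μ` inverts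
`1 - lavg κ` up to constants. -/
theorem neumann_add_lintegral [IsProbabilityMeasure μ] [μ.IsAddLeftInvariant]
    {c : ℝ≥0∞} (hc0 : c ≠ 0) (hκ : κ = q + c • μ) [IsProbabilityMeasure κ] (hf : Measurable f)
    (x : X) :
    neumann q f x + ∫⁻ x, f x ∂μ = f x + lavg κ (neumann q f) x := by
  have hmass : q Set.univ + c = 1 := by
    have := congrArg (fun m : Measure X => m Set.univ) hκ
    simpa using this.symm
  have hc1 : c ≠ ⊤ := fun h => by simp [h] at hmass
  have hq1 : q Set.univ ≠ ⊤ := fun h => by simp [h] at hmass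
  have hsub : 1 - q Set.univ = c := by
    rw [← hmass, ENNReal.add_sub_cancel_left hq1]
  -- The part c • μ contributes c times the integral of the Neumann series, which is exactly ∫ f
  -- because 1 - q(X) = c.
  have hsplit : lavg κ (neumann q f) x = lavg q (neumann q f) x + ∫⁻ x, f x ∂μ := by
    rw [hκ, lavg, lintegral_add_measure]
    congr 1
    change lavg (c • μ) _ x = _
    rw [lavg_smul_left, lintegral_neumann hf, hsub, mul_comm, mul_assoc,
      ENNReal.inv_mul_cancel hc0 hc1, mul_one]
  rw [hsplit, ← add_assoc, ← neumann_eq hf]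

end Resolvent

end Averaging

namespace FlatTorus

variable {b : Module.Basis (Fin 2) ℝ Plane}

/-! ### The resolvent kernel of the Laplacian, from the heat kernel of the plane -/

section Heat

/-- The heat kernel of the plane at time `t`, weighted by the exponential density of rate `K`. -/
def heatDensity (K : ℝ) (z : ℝ × Plane) : ℝ :=
  K * Real.exp (-(K * z.1)) * (4 * Real.pi * z.1)⁻¹ * Real.exp (-(4 * z.1)⁻¹ * ‖z.2‖ ^ 2)

theorem measurable_heatDensity (K : ℝ) : Measurable (heatDensity K) := by
  unfold heatDensity
  fun_prop

theorem heatDensity_nonneg {K : ℝ} (hK : 0 < K) {z : ℝ × Plane} (hz : 0 < z.1) :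
    0 ≤ heatDensity K z := by
  have := Real.pi_pos
  unfold heatDensity
  positivity

theorem integral_gaussian_mul_cos {t : ℝ} (ht : 0 < t) (w : Plane) :
    ∫ y : Plane, Real.exp (-(4 * t)⁻¹ * ‖y‖ ^ 2) * Real.cos (inner ℝ w y)
      = 4 * Real.pi * t * Real.exp (-(t * ‖w‖ ^ 2)) := by
  have ht4 : 0 < (4 * t)⁻¹ := by positivity
  have hre : 0 < (((4 * t)⁻¹ : ℝ) : ℂ).re := by simpa using ht
  have hint := GaussianFourier.integrable_cexp_neg_mul_sq_norm_add hre Complex.I w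
  have h := GaussianFourier.integral_cexp_neg_mul_sq_norm_add hre Complex.I w
  have hrw : ∀ y : Plane, Real.exp (-(4 * t)⁻¹ * ‖y‖ ^ 2) * Real.cos (inner ℝ w y)
      = (Complex.exp (-(((4 * t)⁻¹ : ℝ) : ℂ) * ‖y‖ ^ 2 + Complex.I * (inner ℝ w y : ℝ))).re := by
    intro y
    rw [Complex.exp_re]
    congr 2
    · simp [← Complex.ofReal_pow]
    · simp [← Complex.ofReal_pow]
  simp_rw [hrw]
  have hre2 := integral_re hint
  simp only [RCLike.re_to_complex] at hre2
  rw [hre2, h]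
  have htc : (t : ℂ) ≠ 0 := by exact_mod_cast ht.ne'
  -- In dimension two the Gaussian normalisation carries the exponent 1, so the complex power is
  -- trivial.
  have hfin : ((Module.finrank ℝ Plane : ℂ) / 2) = 1 := by simp
  rw [hfin, Complex.cpow_one]
  have : (Real.pi : ℂ) / (((4 * t)⁻¹ : ℝ) : ℂ)
      * Complex.exp (Complex.I ^ 2 * ‖w‖ ^ 2 / (4 * (((4 * t)⁻¹ : ℝ) : ℂ)))
      = ((4 * Real.pi * t * Real.exp (-(t * ‖w‖ ^ 2)) : ℝ) : ℂ) := by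
    push_cast
    congr 1
    · field_simp
    · congr 1
      rw [Complex.I_sq]
      field_simp
  rw [this, Complex.ofReal_re]

theorem integrable_gaussian {t : ℝ} (ht : 0 < t) :
    Integrable fun y : Plane => Real.exp (-(4 * t)⁻¹ * ‖y‖ ^ 2) := by
  have hre : 0 < (((4 * t)⁻¹ : ℝ) : ℂ).re := by simpa using ht
  have hint := (GaussianFourier.integrable_cexp_neg_mul_sq_norm_add hre 0 (0 : Plane)).re
  refine hint.congr (Filter.Eventually.of_forall fun y => ?_)
  have : -(((4 * t)⁻¹ : ℝ) : ℂ) * ‖y‖ ^ 2 + 0 * ((inner ℝ (0 : Plane) y : ℝ) : ℂ)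
      = ((-(4 * t)⁻¹ * ‖y‖ ^ 2 : ℝ) : ℂ) := by push_cast; ring
  simp only [this, ← Complex.ofReal_exp]
  exact Complex.ofReal_re _

theorem integral_heatDensity_mul_cos (K : ℝ) {t : ℝ} (ht : 0 < t) (w : Plane) :
    ∫ y : Plane, heatDensity K (t, y) * Real.cos (inner ℝ w y)
      = K * Real.exp (-((K + ‖w‖ ^ 2) * t)) := by
  have h : ∀ y : Plane, heatDensity K (t, y) * Real.cos (inner ℝ w y)
      = (K * Real.exp (-(K * t)) * (4 * Real.pi * t)⁻¹)
        * (Real.exp (-(4 * t)⁻¹ * ‖y‖ ^ 2) * Real.cos (inner ℝ w y)) := fun y => by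
    unfold heatDensity; ring
  simp_rw [h]
  rw [integral_const_mul, integral_gaussian_mul_cos ht]
  have hpi := Real.pi_pos
  have : Real.exp (-((K + ‖w‖ ^ 2) * t)) = Real.exp (-(K * t)) * Real.exp (-(t * ‖w‖ ^ 2)) := by
    rw [← Real.exp_add]; congr 1; ring
  rw [this]
  field_simp

/-- The product of time and area on `(0, ∞) × ℝ²`. -/
def timeSpace : Measure (ℝ × Plane) := (volume.restrict (Set.Ioi (0 : ℝ))).prod volume

theorem integrableOn_exp_neg {s : ℝ} (hs : 0 < s) (K : ℝ) :
    IntegrableOn (fun t => K * Real.exp (-(s * t))) (Set.Ioi 0) := by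
  have := (integrableOn_exp_mul_Ioi (neg_neg_of_pos hs) 0).const_mul K
  simpa only [neg_mul, IntegrableOn] using this

theorem setIntegral_exp_neg {s : ℝ} (hs : 0 < s) (K : ℝ) :
    ∫ t in Set.Ioi (0 : ℝ), K * Real.exp (-(s * t)) = K / s := by
  have := integral_exp_mul_Ioi (neg_neg_of_pos hs) 0
  simp only [neg_mul] at this
  rw [integral_const_mul, this]
  simp
  rfl

theorem integrable_heatDensity {K : ℝ} (hK : 0 < K) : Integrable (heatDensity K) timeSpace := by
  rw [timeSpace, integrable_prod_iff (measurable_heatDensity K).aestronglyMeasurable]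
  have hpos : ∀ᵐ t ∂(volume.restrict (Set.Ioi (0 : ℝ))), t ∈ Set.Ioi (0 : ℝ) :=
    ae_restrict_mem measurableSet_Ioi
  constructor
  · filter_upwards [hpos] with t ht
    exact (integrable_gaussian ht).const_mul (K * Real.exp (-(K * t)) * (4 * Real.pi * t)⁻¹)
  · refine (integrableOn_exp_neg hK K).congr ?_
    filter_upwards [hpos] with t ht
    have := integral_heatDensity_mul_cos K ht 0
    simp only [inner_zero_left, Real.cos_zero, mul_one, norm_zero] at this
    rw [integral_congr_ae (g := fun y => heatDensity K (t, y))]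
    · rw [this]; simp
    · exact Filter.Eventually.of_forall fun y =>
        Real.norm_of_nonneg (heatDensity_nonneg hK (z := (t, y)) ht)

theorem ae_timeSpace_pos : ∀ᵐ z ∂timeSpace, 0 < z.1 := by
  have hpos : ∀ᵐ t ∂(volume.restrict (Set.Ioi (0 : ℝ))), 0 < t :=
    ae_restrict_mem measurableSet_Ioi
  exact Measure.quasiMeasurePreserving_fst.ae hpos

/-- The space integral leaves K e^{-(K + |w|²)t}; integrating in time gives the Fourier multiplier
of K(K - Δ)⁻¹. -/
theorem integral_heatDensity_mul_cos_timeSpace {K : ℝ} (hK : 0 < K) (w : Plane) :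
    ∫ z, heatDensity K z * Real.cos (inner ℝ w z.2) ∂timeSpace = K / (K + ‖w‖ ^ 2) := by
  have hint : Integrable (fun z : ℝ × Plane => heatDensity K z * Real.cos (inner ℝ w z.2))
      timeSpace := by
    refine (integrable_heatDensity hK).mul_bdd (c := 1) ?_
      (Filter.Eventually.of_forall fun z => Real.abs_cos_le_one _)
    exact Continuous.aestronglyMeasurable (by fun_prop)
  rw [timeSpace, integral_prod _ hint, ← setIntegral_exp_neg (by positivity) K]
  refine setIntegral_congr_fun measurableSet_Ioi fun t ht => ?_
  exact integral_heatDensity_mul_cos K ht w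

/-- The measure on `(0, ∞) × ℝ²` with density `heatDensity K`. -/
def heatMeasure (K : ℝ) : Measure (ℝ × Plane) :=
  timeSpace.withDensity fun z => ENNReal.ofReal (heatDensity K z)

theorem isProbabilityMeasure_heatMeasure {K : ℝ} (hK : 0 < K) :
    IsProbabilityMeasure (heatMeasure K) := by
  refine ⟨?_⟩
  rw [heatMeasure, withDensity_apply _ MeasurableSet.univ, Measure.restrict_univ,
    ← ofReal_integral_eq_lintegral_ofReal (integrable_heatDensity hK)
      (ae_timeSpace_pos.mono fun z hz => heatDensity_nonneg hK hz)]
  have := integral_heatDensity_mul_cos_timeSpace hK 0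
  simp only [inner_zero_left, Real.cos_zero, mul_one, norm_zero] at this
  rw [this]
  simp [hK.ne']

end Heat

/-- The law on the torus whose averaging operator is `K (K - Δ)⁻¹`. -/
def resolventMeasure (b : Module.Basis (Fin 2) ℝ Plane) (K : ℝ) : Measure (FlatTorus b) :=
  (heatMeasure K).map fun z => proj b z.2

theorem measurable_proj_snd : Measurable fun z : ℝ × Plane => proj b z.2 :=
  (measurable_proj b).comp measurable_snd

theorem isProbabilityMeasure_resolventMeasure {K : ℝ} (hK : 0 < K) :
    IsProbabilityMeasure (resolventMeasure b K) := by
  have := isProbabilityMeasure_heatMeasure hK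
  exact Measure.isProbabilityMeasure_map measurable_proj_snd.aemeasurable

theorem resolventMeasure_map_neg (b : Module.Basis (Fin 2) ℝ Plane) (K : ℝ) :
    (resolventMeasure b K).map Neg.neg = resolventMeasure b K := by
  let σ : ℝ × Plane → ℝ × Plane := Prod.map id Neg.neg
  have hσ : MeasurePreserving σ timeSpace timeSpace :=
    (MeasurePreserving.id _).prod (Measure.measurePreserving_neg volume)
  have hM : (heatMeasure K).map σ = heatMeasure K := by
    ext A hA
    rw [Measure.map_apply hσ.measurable hA, heatMeasure,
      withDensity_apply _ (hσ.measurable hA), withDensity_apply _ hA,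
      ← hσ.setLIntegral_comp_preimage hA (measurable_heatDensity K).ennreal_ofReal]
    simp [heatDensity, σ]
  conv_rhs => rw [resolventMeasure, ← hM]
  rw [resolventMeasure, Measure.map_map measurable_neg measurable_proj_snd,
    Measure.map_map measurable_proj_snd hσ.measurable]
  rfl

/-- A null set of the torus lifts to a periodic set that is null in one fundamental domain, hence in
the plane. -/
theorem resolventMeasure_absolutelyContinuous (b : Module.Basis (Fin 2) ℝ Plane) (K : ℝ) :
    resolventMeasure b K ≪ area b := by
  refine Measure.AbsolutelyContinuous.mk fun A hA h0 => ?_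
  rw [area_apply hA] at h0
  have hnull : volume (proj b ⁻¹' A) = 0 := by
    refine (ZSpan.isAddFundamentalDomain' b volume).measure_zero_of_invariant _ (fun g => ?_) h0
    ext y
    rw [Set.mem_vadd_set_iff_neg_vadd_mem]
    have : proj b (-g +ᵥ y) = proj b y := by
      rw [proj_eq_proj_iff]
      have : -(-g +ᵥ y) + y = (g : Plane) := by
        change -(-(g : Plane) + y) + y = _
        abel
      rw [this]
      exact g.2
    simp [this]
  rw [resolventMeasure, Measure.map_apply measurable_proj_snd hA]
  refine withDensity_absolutelyContinuous _ _ ?_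
  exact Measure.quasiMeasurePreserving_snd.preimage_null hnull

/-- This minorisation yields the spectral gap used in the Neumann series. Times in (1, 2] and points
of the bounded fundamental domain already suffice. -/
theorem exists_smul_area_le_resolventMeasure (b : Module.Basis (Fin 2) ℝ Plane) :
    ∃ c : ENNReal, c ≠ 0 ∧ c • area b ≤ resolventMeasure b 1 := by
  obtain ⟨R, hR⟩ := (ZSpan.fundamentalDomain_isBounded b).exists_norm_le
  have hpi := Real.pi_pos
  -- Lower bounds of the three factors of the heat density for 1 < t ≤ 2 and ‖y‖ ≤ R.
  set c : ℝ := Real.exp (-2) * (8 * Real.pi)⁻¹ * Real.exp (-(R ^ 2 / 4)) with hc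
  refine ⟨ENNReal.ofReal c, by simpa using (by positivity : 0 < c), ?_⟩
  refine Measure.le_iff.2 fun A hA => ?_
  have hB : MeasurableSet (proj b ⁻¹' A ∩ ZSpan.fundamentalDomain b) :=
    (measurable_proj b hA).inter (ZSpan.fundamentalDomain_measurableSet b)
  have hS : MeasurableSet (Set.Ioc (1 : ℝ) 2 ×ˢ (proj b ⁻¹' A ∩ ZSpan.fundamentalDomain b)) :=
    measurableSet_Ioc.prod hB
  have hsub : Set.Ioc (1 : ℝ) 2 ×ˢ (proj b ⁻¹' A ∩ ZSpan.fundamentalDomain b)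
      ⊆ (fun z : ℝ × Plane => proj b z.2) ⁻¹' A := fun z hz => hz.2.1
  rw [resolventMeasure, Measure.map_apply measurable_proj_snd hA, Measure.smul_apply,
    area_apply hA, smul_eq_mul]
  refine le_trans ?_ (measure_mono hsub)
  rw [heatMeasure, withDensity_apply _ hS]
  have hvol : timeSpace (Set.Ioc (1 : ℝ) 2 ×ˢ (proj b ⁻¹' A ∩ ZSpan.fundamentalDomain b))
      = volume (proj b ⁻¹' A ∩ ZSpan.fundamentalDomain b) := by
    rw [timeSpace, Measure.prod_prod, Measure.restrict_apply measurableSet_Ioc,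
      Set.inter_eq_left.2 (show Set.Ioc (1 : ℝ) 2 ⊆ Set.Ioi 0 from
        fun t ht => lt_trans one_pos ht.1), Real.volume_Ioc]
    norm_num
  rw [← hvol, ← setLIntegral_const]
  refine setLIntegral_mono' hS fun z hz => ENNReal.ofReal_le_ofReal ?_
  obtain ⟨⟨h1, h2⟩, -, hz2⟩ := hz
  have hn := hR _ hz2
  have hR0 : 0 ≤ R := (norm_nonneg _).trans hn
  rw [hc, heatDensity]
  have e1 : Real.exp (-2) ≤ Real.exp (-(1 * z.1)) := Real.exp_le_exp.2 (by linarith)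
  have e2 : (8 * Real.pi)⁻¹ ≤ (4 * Real.pi * z.1)⁻¹ := by
    apply inv_anti₀
    · positivity
    · nlinarith
  have e3 : Real.exp (-(R ^ 2 / 4)) ≤ Real.exp (-(4 * z.1)⁻¹ * ‖z.2‖ ^ 2) := by
    refine Real.exp_le_exp.2 ?_
    have i1 : (4 * z.1)⁻¹ ≤ 1 / 4 := by
      rw [inv_le_comm₀ (by positivity) (by norm_num)]
      linarith
    have i2 : ‖z.2‖ ^ 2 ≤ R ^ 2 := pow_le_pow_left₀ (norm_nonneg _) hn 2
    have i3 : (0 : ℝ) ≤ (4 * z.1)⁻¹ := by positivity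
    nlinarith [mul_le_mul i1 i2 (sq_nonneg _) (by norm_num)]
  rw [one_mul]
  gcongr

theorem integral_wave_zero {K : ℝ} (hK : 0 < K) (m : Fin 2 → ℤ) :
    ∫ y, wave b m 0 y ∂(resolventMeasure b K) = K / (K + freqSq b m) := by
  have := isProbabilityMeasure_heatMeasure hK
  set w : Plane := (InnerProductSpace.toDual ℝ Plane).symm (phase b m)
  have hw : ∀ y, inner ℝ w y = phase b m y := fun y =>
    InnerProductSpace.toDual_symm_apply
  have hnorm : ‖w‖ ^ 2 = freqSq b m := by
    rw [← (EuclideanSpace.basisFun (Fin 2) ℝ).sum_sq_norm_inner_left w, freqSq]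
    simp [hw]
  rw [resolventMeasure, integral_map measurable_proj_snd.aemeasurable
      (smooth_wave m 0).continuous.aestronglyMeasurable, heatMeasure,
    integral_withDensity_eq_integral_toReal_smul (measurable_heatDensity K).ennreal_ofReal
      (by simp), ← hnorm, ← integral_heatDensity_mul_cos_timeSpace hK]
  refine integral_congr_ae (ae_timeSpace_pos.mono fun z hz => ?_)
  simp only [wave_proj, hw, ENNReal.toReal_ofReal (heatDensity_nonneg hK hz), smul_eq_mul,
    sub_zero]

theorem integral_wave_pi_div_two (K : ℝ) (m : Fin 2 → ℤ) :
    ∫ y, wave b m (Real.pi / 2) y ∂(resolventMeasure b K) = 0 := by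
  have hodd : ∀ x : FlatTorus b, wave b m (Real.pi / 2) (-x) = -wave b m (Real.pi / 2) x := by
    intro x
    obtain ⟨y, rfl⟩ := proj_surjective b x
    rw [← proj_neg, wave_proj, wave_proj, Real.cos_sub_pi_div_two, Real.cos_sub_pi_div_two,
      map_neg, Real.sin_neg]
  have h := integral_map (μ := resolventMeasure b K) (measurable_neg.aemeasurable)
    (smooth_wave (b := b) m (Real.pi / 2)).continuous.aestronglyMeasurable
  rw [resolventMeasure_map_neg] at h
  simp only [hodd, integral_neg] at h
  linarith

/-- The addition formula splits the translate into an even and an odd part; the odd part averages to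
zero by symmetry. -/
theorem avg_wave {K : ℝ} (hK : 0 < K) (m : Fin 2 → ℤ) (a : ℝ) (x : FlatTorus b) :
    avg (resolventMeasure b K) (wave b m a) x = K / (K + freqSq b m) * wave b m a x := by
  have := isProbabilityMeasure_resolventMeasure (b := b) hK
  have hadd : ∀ y : FlatTorus b, wave b m a (x + y) = wave b m 0 y * wave b m a x
      + wave b m (Real.pi / 2) y * wave b m (a - Real.pi / 2) x := by
    intro y
    obtain ⟨y, rfl⟩ := proj_surjective b y
    rw [wave_add, wave_proj, wave_proj, sub_zero, Real.cos_sub_pi_div_two]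
  have hint : ∀ a, Integrable (wave b m a) (resolventMeasure b K) := fun a =>
    Integrable.of_bound (smooth_wave m a).continuous.aestronglyMeasurable 1
      (Filter.Eventually.of_forall (abs_wave_le_one m a))
  simp only [avg, hadd]
  rw [integral_add ((hint _).mul_const _) ((hint _).mul_const _), integral_mul_const,
    integral_mul_const, integral_wave_zero hK, integral_wave_pi_div_two]
  ring

/-! ### Distributional and integral forms of the equation -/

section Equation

variable [IsProbabilityMeasure (area b)]

theorem exists_bound_of_continuous {φ : FlatTorus b → ℝ} (hφ : Continuous φ) :
    ∃ C, ∀ x, |φ x| ≤ C := by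
  obtain ⟨C, hC⟩ := isCompact_univ.exists_bound_of_continuousOn hφ.continuousOn
  exact ⟨C, fun x => hC x (Set.mem_univ x)⟩

theorem integrable_mul_continuous {f φ : FlatTorus b → ℝ} (hf : Integrable f (area b))
    (hφ : Continuous φ) : Integrable (fun x => f x * φ x) (area b) := by
  obtain ⟨C, hC⟩ := exists_bound_of_continuous hφ
  exact hf.mul_bdd (c := C) hφ.aestronglyMeasurable (Filter.Eventually.of_forall hC)

theorem continuous_avg {κ : Measure (FlatTorus b)} [IsProbabilityMeasure κ]
    {φ : FlatTorus b → ℝ} (hφ : Continuous φ) : Continuous (avg κ φ) := by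
  obtain ⟨C, hC⟩ := exists_bound_of_continuous hφ
  refine continuous_of_dominated (bound := fun _ => C) (fun x => ?_) (fun x => ?_)
    (integrable_const C) ?_
  · exact (hφ.comp (continuous_const_add x)).aestronglyMeasurable
  · exact Filter.Eventually.of_forall fun y => hC _
  · exact Filter.Eventually.of_forall fun y => hφ.comp (continuous_add_const y)

theorem integral_avg_mul_continuous {K : ℝ} (hK : 0 < K) {f φ : FlatTorus b → ℝ}
    (hf : Integrable f (area b)) (hφ : Continuous φ) :
    ∫ x, avg (resolventMeasure b K) f x * φ x ∂(area b)
      = ∫ x, f x * avg (resolventMeasure b K) φ x ∂(area b) := by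
  have := isProbabilityMeasure_resolventMeasure (b := b) hK
  obtain ⟨C, hC⟩ := exists_bound_of_continuous hφ
  exact integral_avg_mul (resolventMeasure_map_neg b K) hf hφ.measurable hC

/-- On Fourier coefficients the multipliers K/(K + |ξ|²) and 1 + |ξ|²/K cancel. Continuity upgrades
almost everywhere to everywhere. -/
theorem avg_sub_laplacian {K : ℝ} (hK : 0 < K) {φ : FlatTorus b → ℝ} (hφ : Smooth φ)
    (x : FlatTorus b) :
    avg (resolventMeasure b K) (fun x => φ x - laplacian φ x / K) x = φ x := by
  have := isProbabilityMeasure_resolventMeasure (b := b) hK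
  have hc : Continuous fun x => φ x - laplacian φ x / K :=
    hφ.continuous.sub (hφ.continuous_laplacian.div_const K)
  have hi := integrable_of_continuous hc
  refine congrFun (Continuous.ae_eq_iff_eq (area b) (continuous_avg hc) hφ.continuous |>.1 ?_) x
  refine ae_eq_of_integral_wave_eq (integrable_avg hi) (integrable_of_continuous hφ.continuous)
    fun m a => ?_
  have hw := smooth_wave (b := b) m a
  have hne : K + freqSq b m ≠ 0 := (add_pos_of_pos_of_nonneg hK (freqSq_nonneg m)).ne'
  have hlap : ∫ x, laplacian φ x * wave b m a x ∂(area b)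
      = -freqSq b m * ∫ x, φ x * wave b m a x ∂(area b) := by
    rw [integral_laplacian_mul hφ hw, ← integral_const_mul]
    congr 1; ext x
    rw [laplacian_wave]; ring
  have hsplit : ∫ x, (φ x - laplacian φ x / K) * wave b m a x ∂(area b)
      = (1 + freqSq b m / K) * ∫ x, φ x * wave b m a x ∂(area b) := by
    have e : ∀ x, (φ x - laplacian φ x / K) * wave b m a x
        = φ x * wave b m a x - K⁻¹ * (laplacian φ x * wave b m a x) := fun x => by
      field_simp
    simp_rw [e]
    rw [integral_sub (integrable_mul_continuous (integrable_of_continuous hφ.continuous) hw.continuous)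
      ((integrable_mul_continuous (integrable_of_continuous hφ.continuous_laplacian)
        hw.continuous).const_mul _),
      integral_const_mul, hlap]
    field_simp
    ring
  rw [integral_avg_mul_continuous hK hi hw.continuous]
  have e2 : ∀ x, (φ x - laplacian φ x / K) * avg (resolventMeasure b K) (wave b m a) x
      = K / (K + freqSq b m) * ((φ x - laplacian φ x / K) * wave b m a x) := fun x => by
    rw [avg_wave hK]; ring
  simp_rw [e2]
  rw [integral_const_mul, hsplit]
  field_simp

/-- The total source `∑ᵢ k(x - pᵢ)`, with `k` the density of the resolvent measure. -/
def totalSource {N : ℕ} (b : Module.Basis (Fin 2) ℝ Plane) (K : ℝ) (p : Fin N → FlatTorus b)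
    (x : FlatTorus b) : ENNReal :=
  ∑ i, source (resolventMeasure b K) (area b) (p i) x

variable {N : ℕ} {p : Fin N → FlatTorus b}

theorem measurable_totalSource (K : ℝ) : Measurable (totalSource b K p) :=
  Finset.measurable_fun_sum _ fun _ _ => measurable_source _

theorem lintegral_totalSource {K : ℝ} (hK : 0 < K) :
    ∫⁻ x, totalSource b K p x ∂(area b) = N := by
  have := isProbabilityMeasure_resolventMeasure (b := b) hK
  simp only [totalSource]
  rw [lintegral_finsetSum _ fun i _ => measurable_source _]
  simp [lintegral_source (resolventMeasure_absolutelyContinuous b K)]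

theorem ae_totalSource_lt_top {K : ℝ} (hK : 0 < K) :
    ∀ᵐ x ∂(area b), totalSource b K p x < ⊤ :=
  ae_lt_top (measurable_totalSource K) (by rw [lintegral_totalSource hK]; simp)

theorem integrable_totalSource {K : ℝ} (hK : 0 < K) :
    Integrable (fun x => (totalSource b K p x).toReal) (area b) :=
  integrable_toReal_of_lintegral_ne_top (measurable_totalSource K).aemeasurable
    (by rw [lintegral_totalSource hK]; simp)

theorem integral_totalSource_mul {K : ℝ} (hK : 0 < K) {φ : FlatTorus b → ℝ}
    (hφ : Continuous φ) :
    ∫ x, (totalSource b K p x).toReal * φ x ∂(area b)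
      = ∑ i, avg (resolventMeasure b K) φ (p i) := by
  have := isProbabilityMeasure_resolventMeasure (b := b) hK
  have hac := resolventMeasure_absolutelyContinuous b K
  have hi : ∀ i, Integrable (fun x =>
      (source (resolventMeasure b K) (area b) (p i) x).toReal) (area b) := fun i =>
    integrable_toReal_of_lintegral_ne_top (measurable_source _).aemeasurable
      (by rw [lintegral_source hac]; simp)
  have hsum : ∀ᵐ x ∂(area b), (totalSource b K p x).toReal * φ x
      = ∑ i, (source (resolventMeasure b K) (area b) (p i) x).toReal * φ x := by
    filter_upwards [ae_totalSource_lt_top (p := p) hK] with x hx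
    rw [totalSource, ENNReal.toReal_sum, Finset.sum_mul]
    exact (ENNReal.sum_lt_top.1 hx · · |>.ne)
  rw [integral_congr_ae hsum, integral_finsetSum _ fun i _ =>
    integrable_mul_continuous (hi i) hφ]
  exact Finset.sum_congr rfl fun i _ => integral_source_mul hac _ _

/-- `-Δh = 4π ∑ᵢ δ_{pᵢ} - F` in the sense of distributions. -/
def WeakEquation (p : Fin N → FlatTorus b) (h F : FlatTorus b → ℝ) : Prop :=
  ∀ φ : FlatTorus b → ℝ, Smooth φ →
    -∫ x, h x * laplacian φ x ∂(area b)
      = 4 * Real.pi * ∑ i, φ (p i) - ∫ x, F x * φ x ∂(area b)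

/-- The equation `(K - Δ) h = K h - F + 4π ∑ᵢ δ_{pᵢ}`, solved for `h`. -/
def IntegralEquation (K : ℝ) (p : Fin N → FlatTorus b) (h F : FlatTorus b → ℝ) : Prop :=
  h =ᵐ[area b] fun x => avg (resolventMeasure b K) (fun x => h x - F x / K) x
    + 4 * Real.pi / K * (totalSource b K p x).toReal

theorem integral_integralEquation_mul {K : ℝ} (hK : 0 < K) {h F φ : FlatTorus b → ℝ}
    (hh : Integrable h (area b)) (hF : Integrable F (area b)) (hφ : Continuous φ) :
    ∫ x, (avg (resolventMeasure b K) (fun x => h x - F x / K) x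
        + 4 * Real.pi / K * (totalSource b K p x).toReal) * φ x ∂(area b)
      = ∫ x, (h x - F x / K) * avg (resolventMeasure b K) φ x ∂(area b)
        + 4 * Real.pi / K * ∑ i, avg (resolventMeasure b K) φ (p i) := by
  have := isProbabilityMeasure_resolventMeasure (b := b) hK
  have hi : Integrable (fun x => h x - F x / K) (area b) := hh.sub (hF.div_const K)
  simp only [add_mul, mul_assoc (4 * Real.pi / K)]
  rw [integral_add (integrable_mul_continuous (integrable_avg hi) hφ)
    ((integrable_mul_continuous (integrable_totalSource hK) hφ).const_mul _),
    integral_avg_mul_continuous hK hi hφ, integral_const_mul, integral_totalSource_mul hK hφ]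

/-- Testing with waves, which are eigenfunctions of Δ and of the average, matches all Fourier
coefficients. The weak form does not involve K, so an equation established for one K may be reread
for any other. -/
theorem WeakEquation.integralEquation {K : ℝ} (hK : 0 < K) {h F : FlatTorus b → ℝ}
    (hh : Integrable h (area b)) (hF : Integrable F (area b)) (H : WeakEquation p h F) :
    IntegralEquation K p h F := by
  have := isProbabilityMeasure_resolventMeasure (b := b) hK
  have hi : Integrable (fun x => h x - F x / K) (area b) := hh.sub (hF.div_const K)
  refine ae_eq_of_integral_wave_eq hh
    ((integrable_avg hi).add ((integrable_totalSource hK).const_mul _)) fun m a => ?_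
  have hw := smooth_wave (b := b) m a
  rw [integral_integralEquation_mul hK hh hF hw.continuous]
  have hne : K + freqSq b m ≠ 0 := (add_pos_of_pos_of_nonneg hK (freqSq_nonneg m)).ne'
  have hH := H _ hw
  have e1 : ∀ x, h x * laplacian (wave b m a) x = -freqSq b m * (h x * wave b m a x) :=
    fun x => by rw [laplacian_wave]; ring
  have e2 : ∀ x, (h x - F x / K) * avg (resolventMeasure b K) (wave b m a) x
      = K / (K + freqSq b m) * (h x * wave b m a x)
        - (K + freqSq b m)⁻¹ * (F x * wave b m a x) := fun x => by
    rw [avg_wave hK]; field_simp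
  simp_rw [e1] at hH
  simp_rw [e2, avg_wave hK]
  rw [integral_const_mul] at hH
  rw [integral_sub ((integrable_mul_continuous hh hw.continuous).const_mul _)
    ((integrable_mul_continuous hF hw.continuous).const_mul _), integral_const_mul,
    integral_const_mul, ← Finset.mul_sum]
  have e3 : ∫ x, F x * wave b m a x ∂(area b) = 4 * Real.pi * ∑ i, wave b m a (p i)
      - freqSq b m * ∫ x, h x * wave b m a x ∂(area b) := by linarith
  rw [e3]
  field_simp
  ring

/-- Test with φ - Δφ/K: self-adjointness moves the average onto it and returns φ. -/
theorem IntegralEquation.weakEquation {K : ℝ} (hK : 0 < K) {h F : FlatTorus b → ℝ}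
    (hh : Integrable h (area b)) (hF : Integrable F (area b)) (H : IntegralEquation K p h F) :
    WeakEquation p h F := by
  intro φ hφ
  have hc : Continuous fun x => φ x - laplacian φ x / K :=
    hφ.continuous.sub (hφ.continuous_laplacian.div_const K)
  have h1 := integral_integralEquation_mul (p := p) hK hh hF hc
  rw [← integral_congr_ae (H.mono fun x hx => congrArg (· * (φ x - laplacian φ x / K)) hx)] at h1
  simp_rw [avg_sub_laplacian hK hφ] at h1
  have e1 : ∀ x, h x * (φ x - laplacian φ x / K)
      = h x * φ x - K⁻¹ * (h x * laplacian φ x) := fun x => by field_simp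
  have e2 : ∀ x, (h x - F x / K) * φ x = h x * φ x - K⁻¹ * (F x * φ x) := fun x => by
    field_simp
  simp_rw [e1, e2] at h1
  rw [integral_sub (integrable_mul_continuous hh hφ.continuous)
    ((integrable_mul_continuous hh hφ.continuous_laplacian).const_mul _), integral_const_mul,
    integral_sub (integrable_mul_continuous hh hφ.continuous)
    ((integrable_mul_continuous hF hφ.continuous).const_mul _), integral_const_mul] at h1
  have hK' := hK.ne'
  field_simp at h1
  linarith

end Equation

/-! ### The monotone iteration -/

/-- The nonlinearity `t - e⁻ᵗ (1 - e⁻ᵗ)` of the iteration. -/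
def damp (t : ℝ) : ℝ := t - Real.exp (-t) * (1 - Real.exp (-t))

theorem continuous_damp : Continuous damp := by
  unfold damp
  fun_prop

theorem damp_nonneg {t : ℝ} (ht : 0 ≤ t) : 0 ≤ damp t := by
  have h1 : 1 - Real.exp (-t) ≤ t := by linarith [Real.add_one_le_exp (-t)]
  have h2 : Real.exp (-t) ≤ 1 := Real.exp_le_one_iff.2 (by linarith)
  have h3 := Real.exp_pos (-t)
  unfold damp
  nlinarith

theorem damp_le {t : ℝ} (ht : 0 ≤ t) : damp t ≤ t := by
  have h2 : Real.exp (-t) ≤ 1 := Real.exp_le_one_iff.2 (by linarith)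
  have h3 := Real.exp_pos (-t)
  unfold damp
  nlinarith

/-- With x = e⁻ˢ and y = e⁻ᵗ the increment is (t - s) + (x - y)(1 - x - y). It is nonnegative
because 0 ≤ x - y ≤ t - s and x + y ≤ 2; both upper bounds use x ≤ 1, that is s ≥ 0. -/
theorem damp_mono {s t : ℝ} (hs : 0 ≤ s) (hst : s ≤ t) : damp s ≤ damp t := by
  have hx : Real.exp (-s) ≤ 1 := Real.exp_le_one_iff.2 (by linarith)
  have hyx : Real.exp (-t) ≤ Real.exp (-s) := Real.exp_le_exp.2 (by linarith)
  have hy := Real.exp_pos (-t)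
  have hfac : Real.exp (-t) = Real.exp (-s) * Real.exp (-(t - s)) := by
    rw [← Real.exp_add]; congr 1; ring
  have h1 : 1 - (t - s) ≤ Real.exp (-(t - s)) := by linarith [Real.add_one_le_exp (-(t - s))]
  have hxp := Real.exp_pos (-s)
  have hdiff : Real.exp (-s) - Real.exp (-t) ≤ t - s := by
    rw [hfac]
    nlinarith
  unfold damp
  nlinarith [mul_nonneg (sub_nonneg.2 hyx) (add_pos hxp hy).le]

/-- The extension of `damp` to `[0, ∞]`. -/
def edamp (g : ENNReal) : ENNReal := if g = ⊤ then ⊤ else ENNReal.ofReal (damp g.toReal)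

theorem edamp_of_ne_top {g : ENNReal} (hg : g ≠ ⊤) : edamp g = ENNReal.ofReal (damp g.toReal) :=
  if_neg hg

theorem monotone_edamp : Monotone edamp := by
  intro g g' h
  by_cases hg' : g' = ⊤
  · simp [edamp, hg']
  have hg : g ≠ ⊤ := ne_top_of_le_ne_top hg' h
  rw [edamp_of_ne_top hg, edamp_of_ne_top hg']
  exact ENNReal.ofReal_le_ofReal (damp_mono ENNReal.toReal_nonneg (ENNReal.toReal_mono hg' h))

theorem edamp_iSup {g : ℕ → ENNReal} (hg : Monotone g) (h : ⨆ n, g n ≠ ⊤) :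
    ⨆ n, edamp (g n) = edamp (⨆ n, g n) := by
  refine iSup_eq_of_tendsto (monotone_edamp.comp hg) ?_
  have hn : ∀ n, g n ≠ ⊤ := fun n => ne_top_of_le_ne_top h (le_iSup g n)
  simp_rw [edamp_of_ne_top h, edamp_of_ne_top (hn _)]
  exact ENNReal.tendsto_ofReal ((continuous_damp.tendsto _).comp
    ((ENNReal.tendsto_toReal h).comp (tendsto_atTop_iSup hg)))

variable {N : ℕ} {p : Fin N → FlatTorus b}

/-- One step of the iteration for minus the solution. -/
def iterStep (K : ℝ) (p : Fin N → FlatTorus b) (g : FlatTorus b → ENNReal) (x : FlatTorus b) :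
    ENNReal :=
  lavg (resolventMeasure b K) (fun x => edamp (g x)) x
    + ENNReal.ofReal (4 * Real.pi / K) * totalSource b K p x

theorem iterStep_mono (K : ℝ) : Monotone (iterStep K p) := fun _ _ h x =>
  add_le_add_left (lavg_mono (fun x => monotone_edamp (h x)) x) _

/-- The limit of the iteration, minus the maximal solution. -/
def iterLimit (K : ℝ) (p : Fin N → FlatTorus b) (x : FlatTorus b) : ENNReal :=
  ⨆ n, (iterStep K p)^[n] 0 x

theorem monotone_iterate (K : ℝ) : Monotone fun n => (iterStep K p)^[n] 0 :=
  monotone_nat_of_le_succ fun n => by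
    induction n with
    | zero => intro x; simp
    | succ n ih =>
      rw [Function.iterate_succ_apply', Function.iterate_succ_apply']
      exact iterStep_mono K ih

section Equation

variable [IsProbabilityMeasure (area b)]

theorem measurable_iterate {K : ℝ} (hK : 0 < K) (n : ℕ) :
    Measurable ((iterStep K p)^[n] 0) := by
  have := isProbabilityMeasure_resolventMeasure (b := b) hK
  induction n with
  | zero => exact measurable_const
  | succ n ih =>
    rw [Function.iterate_succ_apply']
    exact (measurable_lavg (monotone_edamp.measurable.comp ih)).add
      ((measurable_totalSource K).const_mul _)

theorem measurable_iterLimit {K : ℝ} (hK : 0 < K) : Measurable (iterLimit K p) :=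
  Measurable.iSup fun n => measurable_iterate hK n

/-- Monotone convergence passes the supremum through the average. Finiteness is needed only almost
everywhere, since averages ignore null sets. -/
theorem iterLimit_eq {K : ℝ} (hK : 0 < K) (h : ∀ᵐ x ∂(area b), iterLimit K p x < ⊤)
    (x : FlatTorus b) : iterLimit K p x = iterStep K p (iterLimit K p) x := by
  have hac := resolventMeasure_absolutelyContinuous b K
  have h1 : iterLimit K p x = ⨆ n, (iterStep K p)^[n + 1] 0 x := by
    refine le_antisymm (iSup_le fun n => ?_) (iSup_le fun n =>
      le_iSup (fun n => (iterStep K p)^[n] 0 x) (n + 1))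
    exact (monotone_iterate K (Nat.le_succ n) x).trans
      (le_iSup (fun n => (iterStep K p)^[n + 1] 0 x) n)
  have h2 : lavg (resolventMeasure b K) (fun x => edamp (iterLimit K p x)) x
      = ⨆ n, lavg (resolventMeasure b K) (fun x => edamp ((iterStep K p)^[n] 0 x)) x := by
    have hae : (fun x => edamp (iterLimit K p x))
        =ᵐ[area b] fun x => ⨆ n, edamp ((iterStep K p)^[n] 0 x) := by
      filter_upwards [h] with x hx
      exact (edamp_iSup (fun _ _ hmn => monotone_iterate K hmn x) hx.ne).symm
    rw [lavg_congr_ae hac hae]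
    exact lintegral_iSup
      (fun n => (monotone_edamp.measurable.comp (measurable_iterate hK n)).comp
        (measurable_const_add x))
      (fun _ _ hmn y => monotone_edamp (monotone_iterate K hmn (x + y)))
  rw [h1, iterStep, h2, ENNReal.iSup_add]
  exact iSup_congr fun n => by rw [Function.iterate_succ_apply', iterStep]

theorem integrable_damp {h : FlatTorus b → ℝ} (hh : Integrable h (area b))
    (h0 : ∀ᵐ x ∂(area b), 0 ≤ h x) : Integrable (fun x => damp (h x)) (area b) := by
  refine hh.mono (continuous_damp.comp_aestronglyMeasurable hh.aestronglyMeasurable) ?_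
  filter_upwards [h0] with x hx
  rw [Real.norm_of_nonneg (damp_nonneg hx), Real.norm_of_nonneg hx]
  exact damp_le hx

theorem avg_mono_ae {κ : Measure (FlatTorus b)} [IsProbabilityMeasure κ] (hκ : κ ≪ area b)
    {f g : FlatTorus b → ℝ} (hf : Integrable f (area b)) (hg : Integrable g (area b))
    (h : f ≤ᵐ[area b] g) : avg κ f ≤ᵐ[area b] avg κ g := by
  filter_upwards [ae_integrable_translate (κ := κ) hf, ae_integrable_translate (κ := κ) hg]
    with x h1 h2
  exact integral_mono_ae h1 h2 (ae_translate hκ h x)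

/-- The limit of the iteration lies below every nonnegative supersolution. -/
theorem iterLimit_le {K : ℝ} (hK : 0 < K) {h F : FlatTorus b → ℝ}
    (hh : Integrable h (area b)) (h0 : ∀ᵐ x ∂(area b), 0 ≤ h x) (hF : Integrable F (area b))
    (H : IntegralEquation K p h F)
    (hle : ∀ᵐ x ∂(area b), F x ≤ K * (Real.exp (-h x) * (1 - Real.exp (-h x)))) :
    ∀ᵐ x ∂(area b), iterLimit K p x ≤ ENNReal.ofReal (h x) := by
  have := isProbabilityMeasure_resolventMeasure (b := b) hK
  have hac := resolventMeasure_absolutelyContinuous b K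
  have hd := integrable_damp hh h0
  -- The bound on F says h - F/K ≥ damp h, and averaging preserves this.
  have hsuper : ∀ᵐ x ∂(area b), avg (resolventMeasure b K) (fun x => damp (h x)) x
      + 4 * Real.pi / K * (totalSource b K p x).toReal ≤ h x := by
    have hmono := avg_mono_ae hac hd (hh.sub (hF.div_const K)) (by
      filter_upwards [hle] with x hx
      have : F x / K ≤ Real.exp (-h x) * (1 - Real.exp (-h x)) := by
        rw [div_le_iff₀ hK]; linarith
      simp only [damp, Pi.sub_apply]
      linarith)
    filter_upwards [hmono, H] with x h1 h2
    rw [h2]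
    exact add_le_add_left h1 _
  have hstep : ∀ n, ∀ᵐ x ∂(area b), (iterStep K p)^[n] 0 x ≤ ENNReal.ofReal (h x) := by
    intro n
    induction n with
    | zero => exact Filter.Eventually.of_forall fun x => zero_le
    | succ n ih =>
      have hed : (fun x => edamp ((iterStep K p)^[n] 0 x))
          ≤ᵐ[area b] fun x => ENNReal.ofReal (damp (h x)) := by
        filter_upwards [ih, h0] with x hx hx0
        refine (monotone_edamp hx).trans ?_
        rw [edamp_of_ne_top ENNReal.ofReal_ne_top, ENNReal.toReal_ofReal hx0]
      filter_upwards [hsuper, ofReal_avg_ae hac hd (h0.mono fun x hx => damp_nonneg hx),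
        ae_totalSource_lt_top (p := p) hK] with x h1 h2 h3
      have hpi := Real.pi_pos
      have h4 : 0 ≤ 4 * Real.pi / K := by positivity
      rw [Function.iterate_succ_apply', iterStep]
      calc _ ≤ lavg (resolventMeasure b K) (fun x => ENNReal.ofReal (damp (h x))) x
            + ENNReal.ofReal (4 * Real.pi / K) * totalSource b K p x :=
            add_le_add_left (lavg_mono_ae hac hed x) _
        _ = ENNReal.ofReal (avg (resolventMeasure b K) (fun x => damp (h x)) x)
            + ENNReal.ofReal (4 * Real.pi / K * (totalSource b K p x).toReal) := by
            rw [h2, ENNReal.ofReal_mul h4, ENNReal.ofReal_toReal h3.ne]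
        _ = ENNReal.ofReal (avg (resolventMeasure b K) (fun x => damp (h x)) x
            + 4 * Real.pi / K * (totalSource b K p x).toReal) := by
            refine (ENNReal.ofReal_add ?_ (mul_nonneg h4 ENNReal.toReal_nonneg)).symm
            exact integral_nonneg_of_ae
              ((ae_translate hac h0 x).mono fun y hy => damp_nonneg hy)
        _ ≤ _ := ENNReal.ofReal_le_ofReal h1
  filter_upwards [ae_all_iff.2 hstep] with x hx
  exact iSup_le hx

theorem ae_iterLimit_lt_top {K : ℝ} {h : FlatTorus b → ℝ}
    (hle : ∀ᵐ x ∂(area b), iterLimit K p x ≤ ENNReal.ofReal (h x)) :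
    ∀ᵐ x ∂(area b), iterLimit K p x < ⊤ :=
  hle.mono fun _ hx => hx.trans_lt ENNReal.ofReal_lt_top

theorem integrable_iterLimit {K : ℝ} (hK : 0 < K) {h : FlatTorus b → ℝ}
    (hh : Integrable h (area b))
    (hle : ∀ᵐ x ∂(area b), iterLimit K p x ≤ ENNReal.ofReal (h x)) :
    Integrable (fun x => (iterLimit K p x).toReal) (area b) := by
  refine integrable_toReal_of_lintegral_ne_top (measurable_iterLimit hK).aemeasurable ?_
  exact ne_top_of_le_ne_top hh.lintegral_lt_top.ne (lintegral_mono_ae hle)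

theorem integralEquation_iterLimit {K : ℝ} (hK : 0 < K)
    (hfin : ∀ᵐ x ∂(area b), iterLimit K p x < ⊤) :
    IntegralEquation K p (fun x => (iterLimit K p x).toReal) (fun x =>
      K * (Real.exp (-(iterLimit K p x).toReal)
        * (1 - Real.exp (-(iterLimit K p x).toReal)))) := by
  have := isProbabilityMeasure_resolventMeasure (b := b) hK
  have hac := resolventMeasure_absolutelyContinuous b K
  have hpi := Real.pi_pos
  have hed : ∀ᵐ x ∂(area b), edamp (iterLimit K p x) < ⊤ := by
    filter_upwards [hfin] with x hx
    rw [edamp_of_ne_top hx.ne]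
    exact ENNReal.ofReal_lt_top
  filter_upwards [hfin] with x hx
  have hx2 := hx
  rw [iterLimit_eq hK hfin x, iterStep, ENNReal.add_lt_top] at hx2
  have h1 : avg (resolventMeasure b K) (fun x => (edamp (iterLimit K p x)).toReal) x
      = (lavg (resolventMeasure b K) (fun x => edamp (iterLimit K p x)) x).toReal :=
    avg_toReal hac (monotone_edamp.measurable.comp (measurable_iterLimit hK)) hed x
  have h2 : (fun x => (edamp (iterLimit K p x)).toReal)
      =ᵐ[area b] fun x => (iterLimit K p x).toReal - K * (Real.exp (-(iterLimit K p x).toReal)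
        * (1 - Real.exp (-(iterLimit K p x).toReal))) / K := by
    filter_upwards [hfin] with x hx
    rw [edamp_of_ne_top hx.ne, ENNReal.toReal_ofReal (damp_nonneg ENNReal.toReal_nonneg), damp,
      mul_div_cancel_left₀ _ hK.ne']
  rw [← avg_congr_ae hac h2, h1]
  conv_lhs => rw [iterLimit_eq hK hfin x, iterStep, ENNReal.toReal_add hx2.1.ne hx2.2.ne,
    ENNReal.toReal_mul, ENNReal.toReal_ofReal (by positivity)]

/-! ### Solutions -/

theorem IsVortexSolution.weakEquation {ε : ℝ} {v : FlatTorus b → ℝ}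
    (hv : IsVortexSolution p ε v) :
    WeakEquation p (fun x => -v x)
      (fun x => 1 / ε ^ 2 * (Real.exp (v x) * (1 - Real.exp (v x)))) := by
  intro φ hφ
  have h := hv.equation φ hφ
  simp only [neg_mul, integral_neg, neg_neg, mul_assoc (1 / ε ^ 2)]
  rw [integral_const_mul]
  linarith

theorem integral_avg {κ : Measure (FlatTorus b)} [IsProbabilityMeasure κ]
    (hs : κ.map Neg.neg = κ) {f : FlatTorus b → ℝ} (hf : Integrable f (area b)) :
    ∫ x, avg κ f x ∂(area b) = ∫ x, f x ∂(area b) := by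
  have := integral_avg_mul (φ := fun _ => 1) (C := 1) hs hf measurable_const (by simp)
  simpa [avg_const] using this

/-- Every distributional solution is nonpositive. -/
theorem IsVortexSolution.ae_nonpos {ε : ℝ} (hε : 0 < ε) {v : FlatTorus b → ℝ}
    (hv : IsVortexSolution p ε v) : ∀ᵐ x ∂(area b), v x ≤ 0 := by
  have hK : 0 < 1 / ε ^ 2 := by positivity
  set K := 1 / ε ^ 2
  have := isProbabilityMeasure_resolventMeasure (b := b) hK
  have hac := resolventMeasure_absolutelyContinuous b K
  have hpi := Real.pi_pos
  have H := hv.weakEquation.integralEquation hK hv.integrable.neg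
    (hv.integrable_nonlinear.const_mul K)
  set f : FlatTorus b → ℝ := fun x => v x + Real.exp (v x) * (1 - Real.exp (v x)) with hf
  have hfi : Integrable f (area b) := hv.integrable.add hv.integrable_nonlinear
  have hneg : ∀ x, avg (resolventMeasure b K)
      (fun x => -v x - K * (Real.exp (v x) * (1 - Real.exp (v x))) / K) x
      = -avg (resolventMeasure b K) f x := fun x => by
    rw [avg, avg, ← integral_neg]
    congr 1; ext y
    rw [mul_div_cancel_left₀ _ hK.ne', hf]
    ring
  -- The integral equation reads v = avg f minus a nonnegative source, hence v⁺ ≤ avg f⁺.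
  have hle : ∀ᵐ x ∂(area b), max (v x) 0 ≤ avg (resolventMeasure b K) (fun x => max (f x) 0) x := by
    have hmono := avg_mono_ae hac hfi hfi.pos_part
      (Filter.Eventually.of_forall fun x => le_max_left _ _)
    filter_upwards [H, hmono] with x hx h1
    simp only [Pi.neg_apply, hneg] at hx
    refine max_le ?_ (integral_nonneg fun y => le_max_right _ _)
    have : 0 ≤ 4 * Real.pi / K * (totalSource b K p x).toReal := by positivity
    linarith
  -- For v ≤ 0, f = -damp(-v) ≤ 0; for v > 0, the nonlinear term is negative, so f < v.
  have hpt : ∀ x, max (f x) 0 ≤ max (v x) 0 ∧ (0 < v x → max (f x) 0 < max (v x) 0) := by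
    intro x
    rcases le_or_gt (v x) 0 with h0 | h0
    · have := damp_nonneg (t := -v x) (by linarith)
      simp only [damp, neg_neg] at this
      refine ⟨?_, fun h => absurd h (not_lt.2 h0)⟩
      rw [max_eq_right (by rw [hf]; dsimp only; linarith)]
      exact le_max_right _ _
    · have h1 : 1 < Real.exp (v x) := Real.one_lt_exp_iff.2 h0
      have h2 : f x < v x := by rw [hf]; dsimp only; nlinarith
      have h3 : max (f x) 0 < max (v x) 0 := by
        rw [max_eq_left h0.le]
        exact max_lt h2 h0
      exact ⟨h3.le, fun _ => h3⟩
  -- Averaging preserves integrals, so ∫ v⁺ ≤ ∫ f⁺ while f⁺ ≤ v⁺ pointwise: equality holds,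
  -- excluding v > 0.
  have hint : ∫ x, (max (v x) 0 - max (f x) 0) ∂(area b) = 0 := by
    refine le_antisymm ?_ (integral_nonneg fun x => sub_nonneg.2 (hpt x).1)
    rw [integral_sub hv.integrable.pos_part hfi.pos_part, sub_nonpos,
      ← integral_avg (resolventMeasure_map_neg b K) hfi.pos_part]
    exact integral_mono_ae hv.integrable.pos_part (integrable_avg hfi.pos_part) hle
  rw [integral_eq_zero_iff_of_nonneg (fun x => sub_nonneg.2 (hpt x).1)
    (hv.integrable.pos_part.sub hfi.pos_part)] at hint
  filter_upwards [hint] with x hx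
  by_contra! h0
  have := (hpt x).2 h0
  simp only [Pi.zero_apply] at hx
  linarith

/-- A nonnegative supersolution yields a maximal solution. -/
theorem exists_isMaximalVortexSolution {ε : ℝ} (hε : 0 < ε) {h F : FlatTorus b → ℝ}
    (hh : Integrable h (area b)) (h0 : ∀ᵐ x ∂(area b), 0 ≤ h x) (hF : Integrable F (area b))
    (H : WeakEquation p h F)
    (hle : ∀ᵐ x ∂(area b), F x ≤ 1 / ε ^ 2 * (Real.exp (-h x) * (1 - Real.exp (-h x)))) :
    ∃ u : FlatTorus b → ℝ, IsMaximalVortexSolution p ε u := by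
  have hK : 0 < 1 / ε ^ 2 := by positivity
  set K := 1 / ε ^ 2
  have hlim := iterLimit_le hK hh h0 hF (H.integralEquation hK hh hF) hle
  have hfin := ae_iterLimit_lt_top hlim
  have hi := integrable_iterLimit hK hh hlim
  set u : FlatTorus b → ℝ := fun x => -(iterLimit K p x).toReal with hu
  have hu0 : ∀ x, u x ≤ 0 := fun x => neg_nonpos.2 ENNReal.toReal_nonneg
  have hmeas : Measurable u := (measurable_iterLimit hK).ennreal_toReal.neg
  have hnl : Integrable (fun x => Real.exp (u x) * (1 - Real.exp (u x))) (area b) := by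
    refine Integrable.of_bound (by fun_prop) 1 (Filter.Eventually.of_forall fun x => ?_)
    have h1 : Real.exp (u x) ≤ 1 := Real.exp_le_one_iff.2 (hu0 x)
    have h2 := Real.exp_pos (u x)
    rw [Real.norm_of_nonneg (by nlinarith)]
    nlinarith
  have hw := (integralEquation_iterLimit hK hfin).weakEquation hK hi (hnl.const_mul K)
  refine ⟨u, ⟨hi.neg, hnl, fun φ hφ => ?_⟩, fun v hv => ?_⟩
  · have h1 := hw φ hφ
    simp only [mul_assoc K] at h1
    rw [integral_const_mul] at h1
    simp only [hu, neg_mul, integral_neg, mul_assoc] at h1 ⊢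
    linarith
  -- For any solution v, -v is a nonnegative supersolution, with equality in the inequality on F;
  -- the limit therefore lies below it.
  · have hv0 := hv.ae_nonpos hε
    have hvl := iterLimit_le hK hv.integrable.neg (hv0.mono fun x hx => neg_nonneg.2 hx)
      (hv.integrable_nonlinear.const_mul K)
      (hv.weakEquation.integralEquation hK hv.integrable.neg
        (hv.integrable_nonlinear.const_mul K))
      (Filter.Eventually.of_forall fun x => by simp)
    filter_upwards [hvl, hv0] with x hx hx0
    have := ENNReal.toReal_mono ENNReal.ofReal_ne_top hx
    rw [Pi.neg_apply, ENNReal.toReal_ofReal (neg_nonneg.2 hx0)] at this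
    simp only [hu]
    linarith

end Equation

/-! ### A supersolution, uniformly in the vortex points -/

section Supersolution

variable [IsProbabilityMeasure (area b)]

theorem neumann_toReal_ae {κ q : Measure (FlatTorus b)} [IsProbabilityMeasure κ] [SFinite q]
    (hκ : κ ≪ area b) {c : ENNReal} (hc0 : c ≠ 0) (hq : κ = q + c • area b)
    {f : FlatTorus b → ENNReal} (hf : Measurable f) (hfin : ∫⁻ x, f x ∂(area b) ≠ ⊤)
    (hn : ∫⁻ x, neumann q f x ∂(area b) ≠ ⊤) :
    ∀ᵐ x ∂(area b), (neumann q f x).toReal + (∫⁻ x, f x ∂(area b)).toReal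
      = (f x).toReal + avg κ (fun x => (neumann q f x).toReal) x := by
  have hnm := measurable_neumann (q := q) hf
  have hlt := ae_lt_top hnm hn
  filter_upwards [hlt, ae_lt_top hf hfin] with x hx hfx
  have h := neumann_add_lintegral (μ := area b) hc0 hq hf x
  have hl : lavg κ (neumann q f) x ≠ ⊤ := by
    have : f x + lavg κ (neumann q f) x ≠ ⊤ := h ▸ ENNReal.add_ne_top.2 ⟨hx.ne, hfin⟩
    exact (ENNReal.add_ne_top.1 this).2
  rw [avg_toReal hκ hnm hlt, ← ENNReal.toReal_add hx.ne hfin, ← ENNReal.toReal_add hfx.ne hl, h]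

/-- For `λ` at least exponentially large in `N`, there is a nonnegative supersolution. -/
theorem exists_supersolution (b : Module.Basis (Fin 2) ℝ Plane) [IsProbabilityMeasure (area b)] :
    ∃ c : ℝ, 0 < c ∧ ∀ (N : ℕ), 1 ≤ N → ∀ (p : Fin N → FlatTorus b) (K : ℝ),
      32 * Real.pi * N * Real.exp (2 * (8 * Real.pi * N / c)) ≤ K →
      ∃ h F : FlatTorus b → ℝ, Integrable h (area b) ∧ (∀ᵐ x ∂(area b), 0 ≤ h x) ∧
        Integrable F (area b) ∧ WeakEquation p h F ∧
        ∀ᵐ x ∂(area b), F x ≤ K * (Real.exp (-h x) * (1 - Real.exp (-h x))) := by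
  obtain ⟨c, hc0, hcle⟩ := exists_smul_area_le_resolventMeasure b
  set κ := resolventMeasure b 1 with hκdef
  have hκp : IsProbabilityMeasure κ := isProbabilityMeasure_resolventMeasure one_pos
  have hac : κ ≪ area b := resolventMeasure_absolutelyContinuous b 1
  have hcle1 : c ≤ 1 := by
    have := hcle Set.univ
    simpa using this
  have hctop : c ≠ ⊤ := ne_top_of_le_ne_top ENNReal.one_ne_top hcle1
  have hcfin : IsFiniteMeasure (c • area b) := (area b).smul_finite hctop
  set q := κ - c • area b
  have hq : κ = q + c • area b := (Measure.sub_add_cancel_of_le hcle).symm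
  have hqfin : IsFiniteMeasure q := isFiniteMeasure_of_le κ Measure.sub_le
  have hqc : 1 - q Set.univ = c := by
    have := congrArg (fun m : Measure (FlatTorus b) => m Set.univ) hq
    have hmass : q Set.univ + c = 1 := by simpa using this.symm
    rw [← hmass, ENNReal.add_sub_cancel_left (measure_ne_top q _)]
  have hcpos : 0 < c.toReal := ENNReal.toReal_pos hc0 hctop
  have hcinv : c⁻¹ ≠ ⊤ := ENNReal.inv_ne_top.2 hc0
  refine ⟨c.toReal, hcpos, fun N hN p K hK => ?_⟩
  have hpi := Real.pi_pos
  have hNpos : (0 : ℝ) < N := by exact_mod_cast hN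
  -- M = 2T/c, with T the total source strength defined next: it is twice the integral of the source
  -- potential and also bounds the potential of a sink of height 2T.
  set M : ℝ := 8 * Real.pi * N / c.toReal with hM
  have hMpos : 0 < M := by positivity
  set T : ℝ := 4 * Real.pi * N with hT
  have hTpos : 0 < T := by positivity
  have hTM : ENNReal.ofReal (2 * T) * c⁻¹ = ENNReal.ofReal M := by
    rw [← ENNReal.ofReal_toReal hcinv, ← ENNReal.ofReal_mul (by positivity), ENNReal.toReal_inv]
    congr 1
    rw [hM, hT]; ring
  have hTM2 : ENNReal.ofReal T * c⁻¹ = ENNReal.ofReal (M / 2) := by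
    rw [← ENNReal.ofReal_toReal hcinv, ← ENNReal.ofReal_mul (by positivity), ENNReal.toReal_inv]
    congr 1
    rw [hM, hT]; ring
  -- the potential of the point sources
  set S : FlatTorus b → ENNReal := fun x => ENNReal.ofReal (4 * Real.pi) * totalSource b 1 p x
  have hSm : Measurable S := (measurable_totalSource 1).const_mul _
  have hSint : ∫⁻ x, S x ∂(area b) = ENNReal.ofReal T := by
    rw [lintegral_const_mul _ (measurable_totalSource 1), lintegral_totalSource one_pos, hT,
      ENNReal.ofReal_mul (p := 4 * Real.pi) (by positivity), ENNReal.ofReal_natCast]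
  set H₁ := neumann q S with hH₁
  have hH₁m : Measurable H₁ := measurable_neumann hSm
  have hH₁int : ∫⁻ x, H₁ x ∂(area b) = ENNReal.ofReal (M / 2) := by
    rw [hH₁, lintegral_neumann hSm, hqc, hSint, hTM2]
  have hH₁top : ∫⁻ x, H₁ x ∂(area b) ≠ ⊤ := by rw [hH₁int]; exact ENNReal.ofReal_ne_top
  -- the set where the potential is not too large
  set E : Set (FlatTorus b) := {x | H₁ x ≤ ENNReal.ofReal M} with hE
  have hEm : MeasurableSet E := hH₁m measurableSet_Iic
  -- Markov's inequality: the potential has integral M/2, so it exceeds M on area at most 1/2.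
  have hEhalf : 1 / 2 ≤ (area b).real E := by
    have h1 : ENNReal.ofReal M * area b Eᶜ ≤ ENNReal.ofReal (M / 2) := by
      rw [← hH₁int]
      refine le_trans (mul_le_mul_right (measure_mono fun x hx => ?_) _)
        (mul_meas_ge_le_lintegral hH₁m _)
      exact (not_le.1 (show ¬H₁ x ≤ ENNReal.ofReal M from hx)).le
    have h2 := ENNReal.toReal_mono ENNReal.ofReal_ne_top h1
    rw [ENNReal.toReal_mul, ENNReal.toReal_ofReal hMpos.le,
      ENNReal.toReal_ofReal (by positivity)] at h2
    have h3 : (area b).real Eᶜ ≤ 1 / 2 := by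
      by_contra! h
      have : M * (1 / 2) < M * (area b).real Eᶜ := mul_lt_mul_of_pos_left h hMpos
      rw [Measure.real] at this
      linarith
    rw [probReal_compl_eq_one_sub hEm] at h3
    linarith
  have hEpos : 0 < (area b).real E := by linarith
  -- the uniform sink on that set
  set A : ℝ := T / (area b).real E with hA
  have hApos : 0 < A := by positivity
  have hA2 : A ≤ 2 * T := by
    rw [hA, div_le_iff₀ hEpos]
    nlinarith
  set G : FlatTorus b → ENNReal := E.indicator fun _ => ENNReal.ofReal A with hG
  have hGm : Measurable G := measurable_const.indicator hEm
  have hGle : ∀ x, G x ≤ ENNReal.ofReal A := fun x => Set.indicator_le_self _ _ x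
  have hGint : ∫⁻ x, G x ∂(area b) = ENNReal.ofReal T := by
    rw [hG, lintegral_indicator_const hEm, ← ENNReal.ofReal_toReal (measure_ne_top (area b) E),
      ← ENNReal.ofReal_mul hApos.le]
    congr 1
    exact div_mul_cancel₀ _ hEpos.ne'
  have hGtop : ∀ᵐ x ∂(area b), G x < ⊤ :=
    Filter.Eventually.of_forall fun x => (hGle x).trans_lt ENNReal.ofReal_lt_top
  have hF₀m : Measurable (lavg κ G) := measurable_lavg hGm
  have hF₀int : ∫⁻ x, lavg κ G x ∂(area b) = ENNReal.ofReal T := by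
    rw [lintegral_lavg hGm, hGint, measure_univ, mul_one]
  have hF₀le : ∀ x, lavg κ G x ≤ ENNReal.ofReal (2 * T) := fun x => by
    refine ((lavg_mono hGle x).trans (lavg_const _ x).le).trans ?_
    rw [measure_univ, mul_one]
    exact ENNReal.ofReal_le_ofReal hA2
  set H₂ := neumann q (lavg κ G) with hH₂
  have hH₂m : Measurable H₂ := measurable_neumann hF₀m
  have hH₂le : ∀ x, H₂ x ≤ ENNReal.ofReal M := fun x => by
    have := neumann_le (q := q) hF₀le x
    rwa [hqc, hTM] at this
  have hH₂top : ∫⁻ x, H₂ x ∂(area b) ≠ ⊤ := by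
    refine ne_top_of_le_ne_top ENNReal.ofReal_ne_top
      ((lintegral_mono hH₂le).trans (?_ : _ ≤ ENNReal.ofReal M))
    simp
  have hH₁i : Integrable (fun x => (H₁ x).toReal) (area b) :=
    integrable_toReal_of_lintegral_ne_top hH₁m.aemeasurable hH₁top
  have hH₂i : Integrable (fun x => (H₂ x).toReal) (area b) :=
    integrable_toReal_of_lintegral_ne_top hH₂m.aemeasurable hH₂top
  have hGi : Integrable (fun x => (G x).toReal) (area b) :=
    integrable_toReal_of_lintegral_ne_top hGm.aemeasurable
      (by rw [hGint]; exact ENNReal.ofReal_ne_top)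
  -- Since H₂ ≤ M, this constant ensures h ≥ log 2, hence 1 - e⁻ʰ ≥ 1/2.
  set D : ℝ := M + Real.log 2 with hD
  set h : FlatTorus b → ℝ := fun x => (H₁ x).toReal - (H₂ x).toReal + D with hh
  have hhi : Integrable h (area b) := (hH₁i.sub hH₂i).add (integrable_const D)
  have hlog : ∀ x, Real.log 2 ≤ h x := fun x => by
    have h1 : (H₂ x).toReal ≤ M := ENNReal.toReal_le_of_le_ofReal hMpos.le (hH₂le x)
    have h2 : 0 ≤ (H₁ x).toReal := ENNReal.toReal_nonneg
    simp only [hh, hD]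
    linarith
  have hlog2 : 0 < Real.log 2 := Real.log_pos one_lt_two
  -- The two Neumann identities carry the same constant T, which cancels on subtraction; the
  -- constant D is its own average.
  have hint : IntegralEquation 1 p h (fun x => (G x).toReal) := by
    have e1 := neumann_toReal_ae hac hc0 hq hSm (by rw [hSint]; exact ENNReal.ofReal_ne_top)
      hH₁top
    have e2 := neumann_toReal_ae hac hc0 hq hF₀m (by rw [hF₀int]; exact ENNReal.ofReal_ne_top)
      hH₂top
    have a1 := avg_sub_ae (κ := κ) hhi hGi
    have hsub : Integrable (fun x => (H₁ x).toReal - (H₂ x).toReal) (area b) := hH₁i.sub hH₂i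
    have a2 := avg_add_ae (κ := κ) hsub (integrable_const D)
    have a3 := avg_sub_ae (κ := κ) hH₁i hH₂i
    filter_upwards [e1, e2, a1, a2, a3] with x e1 e2 a1 a2 a3
    rw [hSint] at e1
    rw [hF₀int] at e2
    have a4 : avg κ (fun x => (G x).toReal) x = (lavg κ G x).toReal :=
      avg_toReal hac hGm hGtop x
    have a5 : (S x).toReal = 4 * Real.pi * (totalSource b 1 p x).toReal := by
      rw [ENNReal.toReal_mul, ENNReal.toReal_ofReal (by positivity)]
    rw [avg_const] at a2
    simp only [div_one]
    rw [← hκdef, a1, a4, ← a5]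
    have a6 : avg κ h x = avg κ (fun x => (H₁ x).toReal) x - avg κ (fun x => (H₂ x).toReal) x
        + D := by
      rw [← a3, ← a2]
    rw [a6]
    simp only [hh]
    linarith
  refine ⟨h, fun x => (G x).toReal, hhi,
    Filter.Eventually.of_forall fun x => hlog2.le.trans (hlog x), hGi,
    hint.weakEquation one_pos hhi hGi, Filter.Eventually.of_forall fun x => ?_⟩
  have hexp_le : Real.exp (-h x) ≤ 1 / 2 := by
    have : Real.exp (-h x) ≤ Real.exp (-Real.log 2) := Real.exp_le_exp.2 (by linarith [hlog x])
    rwa [Real.exp_neg (Real.log 2), Real.exp_log two_pos, ← one_div] at this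
  have hexp_pos := Real.exp_pos (-h x)
  have hKpos : 0 < K := lt_of_lt_of_le (by positivity) hK
  change (G x).toReal ≤ _
  by_cases hx : x ∈ E
  · have hGx : (G x).toReal = A := by
      rw [hG, Set.indicator_of_mem hx, ENNReal.toReal_ofReal hApos.le]
    have h1 : (H₁ x).toReal ≤ M := ENNReal.toReal_le_of_le_ofReal hMpos.le hx
    have h2 : 0 ≤ (H₂ x).toReal := ENNReal.toReal_nonneg
    have h3 : Real.exp (-(2 * M)) * (1 / 2) ≤ Real.exp (-h x) := by
      have : Real.exp (-(2 * M)) * (1 / 2) = Real.exp (-(2 * M) + -Real.log 2) := by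
        rw [Real.exp_add, Real.exp_neg (Real.log 2), Real.exp_log two_pos, one_div]
      rw [this]
      refine Real.exp_le_exp.2 ?_
      simp only [hh, hD]
      linarith
    have h4 : Real.exp (2 * M) * Real.exp (-(2 * M)) = 1 := by
      rw [← Real.exp_add]; simp
    rw [hGx]
    have hE' := Real.exp_pos (-(2 * M))
    -- On E, h ≤ 2M + log 2, so e⁻ʰ(1 - e⁻ʰ) ≥ e^{-2M}/4; the factor 32πN is 4 · 2T.
    calc A ≤ 2 * T := hA2
      _ = 32 * Real.pi * N * Real.exp (2 * M) * (Real.exp (-(2 * M)) * (1 / 2) * (1 / 2)) := by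
          rw [hT]
          linear_combination (-8 * Real.pi * N) * h4
      _ ≤ K * (Real.exp (-h x) * (1 - Real.exp (-h x))) := by
          refine mul_le_mul hK ?_ (by positivity) hKpos.le
          exact mul_le_mul h3 (by linarith) (by norm_num) hexp_pos.le
  · have hGx : (G x).toReal = 0 := by
      rw [hG, Set.indicator_of_notMem hx, ENNReal.toReal_zero]
    rw [hGx]
    exact mul_nonneg hKpos.le (mul_nonneg hexp_pos.le (by linarith))

end Supersolution

end FlatTorus

end

theorem theorem2p1 (b : Module.Basis (Fin 2) ℝ Plane)
    (hb : volume (ZSpan.fundamentalDomain b) = 1) :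
    ∃ (c : ℝ) (ε₀ : ℕ → ℝ), 0 < c ∧
      (∀ N : ℕ, 1 ≤ N → 0 < ε₀ N) ∧
      (∀ N : ℕ, 2 ≤ N → (N : ℝ) ^ (-(c * (N : ℝ))) ≤ ε₀ N) ∧
      ∀ N : ℕ, 1 ≤ N → ∀ p : Fin N → FlatTorus b, ∀ ε : ℝ, 0 < ε → ε < ε₀ N →
        ∃ u : FlatTorus b → ℝ, FlatTorus.IsMaximalVortexSolution p ε u := by
  have := FlatTorus.isProbabilityMeasure_area hb
  obtain ⟨c, hc, hsuper⟩ := FlatTorus.exists_supersolution b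
  have hpi := Real.pi_pos
  have hlog2 : 0 < Real.log 2 := Real.log_pos one_lt_two
  -- Then e^{2CN} = e^{16πN/c} e^{8N}: the first factor is the required exponential, and e^{8N} =
  -- e^{7N} e^N absorbs 32πN.
  set C : ℝ := 8 * Real.pi / c + 4 with hC
  have hCpos : 0 < C := by positivity
  -- Dividing by log 2 gives e^{-CN} ≥ N^{-(C/log 2)N}, because log N ≥ log 2 for N ≥ 2.
  refine ⟨C / Real.log 2, fun N => Real.exp (-(C * N)), by positivity,
    fun N _ => Real.exp_pos _, fun N hN => ?_, fun N hN p ε hε hεN => ?_⟩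
  · have hN2 : (2 : ℝ) ≤ N := by exact_mod_cast hN
    have hNpos : (0 : ℝ) < N := by linarith
    rw [Real.rpow_def_of_pos hNpos]
    refine Real.exp_le_exp.2 ?_
    have hl : Real.log 2 ≤ Real.log N := Real.log_le_log two_pos hN2
    have h1 : C ≤ Real.log N * (C / Real.log 2) := by
      rw [mul_div_assoc', le_div_iff₀ hlog2]
      nlinarith
    nlinarith
  · have hNR : (1 : ℝ) ≤ N := by exact_mod_cast hN
    have hbig : 32 * Real.pi * N * Real.exp (2 * (8 * Real.pi * N / c)) ≤ 1 / ε ^ 2 := by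
      have h1 : Real.exp (2 * (C * N)) ≤ 1 / ε ^ 2 := by
        rw [le_div_iff₀ (by positivity)]
        have h2 : Real.exp (C * N) * ε ≤ 1 := by
          have := mul_le_mul_of_nonneg_left hεN.le (Real.exp_pos (C * N)).le
          rwa [← Real.exp_add, add_neg_cancel, Real.exp_zero] at this
        have h3 : Real.exp (2 * (C * N)) * ε ^ 2 = (Real.exp (C * N) * ε) ^ 2 := by
          rw [mul_pow, ← Real.exp_nat_mul]
          norm_num
        rw [h3]
        exact pow_le_one₀ (by positivity) h2
      refine le_trans ?_ h1
      have h4 : Real.exp (2 * (C * N))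
          = Real.exp (7 * N) * Real.exp N * Real.exp (2 * (8 * Real.pi * N / c)) := by
        rw [← Real.exp_add, ← Real.exp_add]
        congr 1
        rw [hC]
        field_simp
        ring
      rw [h4]
      have h5 : (N : ℝ) ≤ Real.exp N := by linarith [Real.add_one_le_exp (N : ℝ)]
      have h6 : 32 * Real.pi ≤ Real.exp (7 * N) := by
        have h7 : (2 : ℝ) ≤ Real.exp 1 := by linarith [Real.add_one_le_exp (1 : ℝ)]
        have h8 : (2 : ℝ) ^ 7 ≤ Real.exp 7 := by
          have := pow_le_pow_left₀ two_pos.le h7 7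
          rwa [← Real.exp_nat_mul, Nat.cast_ofNat, mul_one] at this
        have h9 : Real.exp 7 ≤ Real.exp (7 * N) := Real.exp_le_exp.2 (by linarith)
        have := Real.pi_le_four
        linarith
      gcongr
    obtain ⟨h, F, hh, h0, hF, H, hle⟩ := hsuper N hN p _ hbig
    exact FlatTorus.exists_isMaximalVortexSolution hε hh h0 hF H hle
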